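/- **Setting.** A *weighted multigraph* $\mathcal G$ has a vertex set $V$ and edges (multiple edges and loops allowed), every edge $e$ giving two distinct opposite oriented edges $\vec e,\vec e^{\,-1}$. The oriented edges carry weights $w(\vec e)\ge 0$ such that every edge has at least one orientation of positive weight and, for every vertex $u$, the weights of the oriented edges going out of $u$ sum to $1$. The random walk (RW) on $\mathcal G$ is the Markov chain on $V$ with transition matrix $$P(u,v)=\tfrac12\mathbf 1_{\{u=v\}}+\tfrac12\sum_{\vec e:\,u\to v}w(\vec e).$$ An *oriented cycle* is a cyclic order $(\vec e_1,\dots,\vec e_m)$, $m\ge1$, of (distinct) oriented edges of positive weight such that, for all $i$ modulo $m$, $\vec e_i$ ends where $\vec e_{i+1}$ starts and $\vec e_i\ne \vec e_{i+1}^{\,-1}$; its inverse is the cycle $(\vec e_m^{\,-1},\dots,\vec e_1^{\,-1})$. The universal cover $(\mathcal T_{\mathcal G},\circ)$ of $\mathcal G$ rooted at $v_*\in V$ is the tree whose vertices are the non-backtracking paths of $\mathcal G$ starting at $v_*$; the root $\circ$ is the empty path, two paths are joined by an edge if one of them extends the other by one oriented edge, and every oriented edge of the tree has the weight of the oriented edge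 of $\mathcal G$ it comes from. For a vertex $x$ of the tree, $V_x$ is the set of vertices $y$ such that $x$ lies on the path from $\circ$ to $y$, and $B(y,r)$ is the set of vertices that can be reached from $y$ by an oriented path of length at most $r$ with edges of positive weight. The ray to infinity of a trajectory $(\mathcal X_t)_{t\ge0}$ in the tree is $$\xi=\{x:\ \exists s\ge0,\ \mathcal X_s=x\ \text{and}\ \mathcal X_t\in V_x\ \text{for all } t\ge s\}.$$ **Proposition.** Let $\mathcal G$ be a finite weighted multigraph such that the RW on $\mathcal G$ is irreducible and $\mathcal G$ has at least two distinct oriented cycles which are not each other's inverse. There exist constants $C_1,C_2>0$, depending only on $\mathcal G$, such that for every choice of the root $v_*$ and every RW $(\mathcal X_t)_{t\ge0}$ on $(\mathcal T_{\mathcal G},\circ)$ started at $\circ$: 1. for all integers $R\ge0$ and every vertex $x\notin B(\circ,R)$, $\ \mathbb P(\exists t>0,\ \mathcal X_t=x)\le C_1e^{-C_2R}$; 2. for all integers $R,s\ge0$, every vertex $y$ with $\mathbb P(\mathcal X_s=y)>0$ and every vertex $x\notin B(y,R)$, $\ \mathbb P(\exists t>s,\ \mathcal X_t=x\mid \mathcal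 X_s=y)\le C_1e^{-C_2R}$; 3. for all integers $R,t\ge0$, $\ \mathbb P(\xi\cap B(\mathcal X_t,R)=\emptyset)\le C_1e^{-C_2R}$. -/

import Mathlib

/-- A weighted multigraph with vertex set `V` and set of oriented edges `D`. Every (unoriented) edge,
loops included, is a pair of two distinct oriented edges that are exchanged by `rev`. At least one of
them has positive weight, and the weights of the oriented edges going out of a vertex sum to `1`. -/
structure WeightedMultigraph (V D : Type*) where
  /-- the initial vertex -/
  src : D → V
  /-- the opposite oriented edge -/
  rev : D → D
  rev_rev : ∀ e, rev (rev e) = e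
  rev_ne : ∀ e, rev e ≠ e
  /-- the weight -/
  w : D → ℝ
  w_nonneg : ∀ e, 0 ≤ w e
  w_pos_or : ∀ e, 0 < w e ∨ 0 < w (rev e)
  hasSum_w : ∀ u, HasSum (fun e : {e : D // src e = u} => w e.1) 1

namespace WeightedMultigraph

variable {V D : Type*} (G : WeightedMultigraph V D)

/-- The end vertex of an oriented edge. -/
def tgt (e : D) : V := G.src (G.rev e)

open scoped Classical in
/-- The transition matrix of the (lazy) random walk. -/
noncomputable def transition : Matrix V V ℝ := fun u v =>
  1 / 2 * (if u = v then 1 else 0) +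
    1 / 2 * ∑' e : {e : D // G.src e = u ∧ G.tgt e = v}, G.w e.1

/-- An oriented cycle: a cyclic order of (pairwise distinct) oriented edges of positive weight in
which every edge ends where the next one starts and is not the inverse of the next one. -/
def IsOrientedCycle (c : Cycle D) : Prop :=
  c ≠ Cycle.nil ∧ c.Nodup ∧ (∀ e ∈ c, 0 < G.w e) ∧
    c.Chain (fun e f => G.tgt e = G.src f ∧ e ≠ G.rev f)

/-- The two-cycles property: there are two distinct oriented cycles, not inverse to each other. -/
def TwoCycles : Prop :=
  ∃ c₁ c₂ : Cycle D, G.IsOrientedCycle c₁ ∧ G.IsOrientedCycle c₂ ∧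
    c₁ ≠ c₂ ∧ c₁ ≠ (c₂.map G.rev).reverse

/-- `G.IsPath u p v`: the list `p` consists of the consecutive oriented edges of a path from `u` to
`v`, listed from the last one to the first one. -/
def IsPath (u : V) : List D → V → Prop
  | [], v => u = v
  | e :: p, v => G.tgt e = v ∧ IsPath u p (G.src e)

/-- The ball `B(y, r)`: the vertices that can be reached from `y` by an oriented path of length at
most `r`, all of whose edges have positive weight. -/
def ball (y : V) (r : ℕ) : Set V :=
  {z | ∃ p : List D, G.IsPath y p z ∧ (∀ e ∈ p, 0 < G.w e) ∧ p.length ≤ r}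

open scoped Classical in
/-- `X` is a random walk on `G` started at `o`, described by its finite-dimensional laws. -/
def IsRandomWalk (o : V) {Ω : Type*} [MeasurableSpace Ω] (μ : MeasureTheory.Measure Ω)
    (X : ℕ → Ω → V) : Prop :=
  (∀ t x, MeasurableSet {ω | X t ω = x}) ∧
    ∀ (n : ℕ) (x : ℕ → V), μ.real {ω | ∀ i ≤ n, X i ω = x i} =
      (if x 0 = o then 1 else 0) * ∏ i ∈ Finset.range n, G.transition (x i) (x (i + 1))

/-- A vertex of the universal cover of `G` rooted at `v`: a non-backtracking path `path` in `G` from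
`v` to a vertex `label` (edges listed from the last one to the first one). -/
@[ext] structure CoverVertex (v : V) where
  path : List D
  label : V
  isPath : G.IsPath v path label
  nonBacktracking : path.IsChain (fun e f => e ≠ G.rev f)

variable {G} {v : V}

theorem CoverVertex.eq_of_path {x y : G.CoverVertex v} (h : x.path = y.path) : x = y := by
  obtain ⟨p, a, hp, hn⟩ := x
  obtain ⟨q, b, hq, hm⟩ := y
  obtain rfl : p = q := h
  have hab : a = b := by
    cases p with
    | nil => exact hp.symm.trans hq
    | cons e p => exact hp.1.symm.trans hq.1
  subst hab
  rfl

variable (G) in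
open scoped Classical in
/-- Append the edge `e` to a non-backtracking path, and cancel it against the last edge if that edge
is the inverse of `e`. -/
noncomputable def extendPath (e : D) : List D → List D
  | [] => [e]
  | f :: p => if f = G.rev e then p else e :: f :: p

/-- The neighbour of `x` in the universal cover along the oriented edge with label `e`. -/
noncomputable def CoverVertex.step (x : G.CoverVertex v) (e : D) (he : G.src e = x.label) :
    G.CoverVertex v where
  path := G.extendPath e x.path
  label := G.tgt e
  isPath := by
    obtain ⟨p, a, hp, hn⟩ := x
    cases p with
    | nil => exact ⟨rfl, hp.trans he.symm⟩
    | cons f p =>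
      by_cases h : f = G.rev e
      · subst h
        simpa [extendPath, tgt] using hp.2
      · simp only [extendPath, if_neg h]
        exact ⟨rfl, hp.1.trans he.symm, hp.2⟩
  nonBacktracking := by
    obtain ⟨p, a, hp, hn⟩ := x
    cases p with
    | nil => simp [extendPath]
    | cons f p =>
      by_cases h : f = G.rev e
      · simpa [extendPath, h] using hn.tail
      · simp only [extendPath, if_neg h]
        refine List.isChain_cons_cons.2 ⟨fun h' => h ?_, hn⟩
        rw [h', G.rev_rev]

theorem CoverVertex.extendPath_rev (x : G.CoverVertex v) (e : D) :
    G.extendPath (G.rev e) (G.extendPath e x.path) = x.path := by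
  obtain ⟨p, a, hp, hn⟩ := x
  cases p with
  | nil => simp [extendPath, G.rev_rev]
  | cons f p =>
    by_cases h : f = G.rev e
    · subst h
      cases p with
      | nil => simp [extendPath]
      | cons g p =>
        have hg : g ≠ e := fun h' => (List.isChain_cons_cons.1 hn).1 (by rw [h'])
        simp [extendPath, G.rev_rev, hg]
    · simp [extendPath, h, G.rev_rev]

variable (G) in
/-- The oriented edges of the universal cover: `⟨(x, e), _⟩` is the one going out of `x` with
label `e`. -/
abbrev CoverEdge (v : V) : Type _ := {d : G.CoverVertex v × D // G.src d.2 = d.1.label}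

/-- The end vertex of an oriented edge of the universal cover. -/
noncomputable def CoverEdge.tip (d : G.CoverEdge v) : G.CoverVertex v := d.1.1.step d.1.2 d.2

theorem CoverEdge.tip_rev (d : G.CoverEdge v) :
    d.tip.step (G.rev d.1.2) rfl = d.1.1 :=
  CoverVertex.eq_of_path (d.1.1.extendPath_rev d.1.2)

variable (G) in
/-- The universal cover of `G`, rooted at (the empty path from) `v`. -/
noncomputable def universalCover (v : V) : WeightedMultigraph (G.CoverVertex v) (G.CoverEdge v) where
  src d := d.1.1
  rev d := ⟨(d.tip, G.rev d.1.2), rfl⟩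
  rev_rev d := Subtype.ext (Prod.ext d.tip_rev (G.rev_rev _))
  rev_ne d h := G.rev_ne d.1.2 (congrArg (fun d : G.CoverEdge v => d.1.2) h)
  w d := G.w d.1.2
  w_nonneg d := G.w_nonneg _
  w_pos_or d := G.w_pos_or _
  hasSum_w x := by
    let φ : {d : G.CoverEdge v // d.1.1 = x} ≃ {e : D // G.src e = x.label} :=
      { toFun := fun d => ⟨d.1.1.2, by rw [d.1.2, d.2]⟩
        invFun := fun e => ⟨⟨(x, e.1), e.2⟩, rfl⟩
        left_inv := by rintro ⟨⟨⟨y, e⟩, h⟩, rfl⟩; rfl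
        right_inv := fun e => rfl }
    exact (φ.hasSum_iff (f := fun e : {e : D // G.src e = x.label} => G.w e.1)).2
      (G.hasSum_w x.label)

variable (G) in
/-- The root of the universal cover: the empty path. -/
def root (v : V) : G.CoverVertex v := ⟨[], v, rfl, List.isChain_nil⟩

/-- The offspring `V_x` of `x`: the vertices `y` such that `x` lies on the path from the root
to `y`, that is, such that the non-backtracking path of `y` starts with that of `x`. -/
def offspring (x : G.CoverVertex v) : Set (G.CoverVertex v) := {y | x.path <:+ y.path}

/-- The ray to infinity `ξ` of a trajectory `X` in the universal cover. -/
def ray (X : ℕ → G.CoverVertex v) : Set (G.CoverVertex v) :=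
  {x | ∃ s, X s = x ∧ ∀ t ≥ s, X t ∈ offspring x}

end WeightedMultigraph

/-! ### Cycles and periodic orbits. -/

namespace Cycle

/-! Two essentially different cycles make the universal cover non-amenable, so the `n`-step
probabilities decay exponentially, although the walk need not be reversible.

With at most as many edges as vertices, `G` would be, up to orientation, a connected functional
graph, which has a single cycle; hence `two_mul_card_lt`. The surplus of edges yields edge weights
(`exists_expanding_weights`) that lift to an antisymmetric flow on the cover of divergence at least
one. Summing by parts against `g ^ 2` gives a spectral gap (`exists_poincare`), with a constant
independent of the root. Laziness and convexity turn it into a contraction of the `L²` norm weighted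
by the lifted stationary measure (`exists_contraction`), hence a bound `K * r ^ n` (`exists_decay`).

A vertex outside the ball of radius `R` is not reached within `R` steps, so hitting it costs a
geometric tail. After time `t`, the visited vertex nearest to the root lies on the ray; if visited
`n` steps later, it is one of `n + 1` ancestors of the position at time `t`, and if it is outside
the ball then `n > R`. Thus `exists_hitting_bound` serves all three claims. -/

theorem Chain.forall_or_forall_not {α : Type*} {c : Cycle α} {p : α → Prop}
    (h : c.Chain fun a b => p a → p b) : (∀ a ∈ c, p a) ∨ ∀ a ∈ c, ¬ p a := by
  -- Implication is transitive, so the chain condition relates every pair of elements of the cycle.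
  have : IsTrans α (fun a b => p a → p b) := ⟨fun a b c hab hbc ha => hbc (hab ha)⟩
  rw [Cycle.chain_iff_pairwise] at h
  by_cases hp : ∃ a ∈ c, p a
  · obtain ⟨a, ha, hpa⟩ := hp
    exact Or.inl fun b hb => h a ha b hb hpa
  · push Not at hp
    exact Or.inr hp

theorem Chain.reverse {α : Type*} {c : Cycle α} {r : α → α → Prop} (h : c.Chain r) :
    c.reverse.Chain (fun a b => r b a) := by
  induction c using Cycle.induction_on with
  | nil => exact Cycle.Chain.nil _
  | cons a l _ =>
    have h1 : ((a :: l : List α) : Cycle α).reverse = ((a :: l.reverse : List α) : Cycle α) := by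
      rw [Cycle.reverse_coe, List.reverse_cons, Cycle.coe_cons_eq_coe_append]
    rw [h1, Cycle.chain_coe_cons]
    rw [Cycle.chain_coe_cons] at h
    simpa using List.isChain_reverse.2 h

theorem ne_nil_iff_exists_mem {α : Type*} {c : Cycle α} : c ≠ Cycle.nil ↔ ∃ a, a ∈ c := by
  induction c using Cycle.induction_on with
  | nil => simp
  | cons a l _ => simp

theorem exists_coe_cons_of_mem {α : Type*} {c : Cycle α} {a : α} (h : a ∈ c) :
    ∃ l : List α, c = ((a :: l : List α) : Cycle α) := by
  induction c using Quotient.inductionOn with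
  | h l =>
    have h' : a ∈ l := h
    obtain ⟨s, t, rfl⟩ := List.append_of_mem h'
    refine ⟨t ++ s, ?_⟩
    change ((s ++ a :: t : List α) : Cycle α) = _
    rw [Cycle.coe_eq_coe]
    simpa using List.IsRotated.symm ⟨(a :: t).length, by
      rw [← List.cons_append, List.rotate_append_length_eq]⟩

theorem isChain_eq_map_iterate {α : Type*} {f : α → α} (m : List α) (a : α)
    (h : (a :: m).IsChain (fun x y => y = f x)) :
    a :: m = (List.range (m.length + 1)).map fun n => f^[n] a := by
  induction m generalizing a with
  | nil => simp
  | cons b m ih =>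
    rw [List.isChain_cons_cons] at h
    rw [List.length_cons, List.range_succ_eq_map (n := m.length + 1), ih b h.2, h.1]
    simp [Function.comp_def]

/-- A cycle that follows `f` is determined by any of its elements; uniqueness of cycles thus reduces
to the merging of orbits. -/
theorem Chain.eq_periodicOrbit {α : Type*} {c : Cycle α} {f : α → α} {a : α}
    (h : c.Chain fun x y => y = f x) (hn : c.Nodup) (ha : a ∈ c) :
    a ∈ Function.periodicPts f ∧ c = Function.periodicOrbit f a := by
  obtain ⟨l, rfl⟩ := exists_coe_cons_of_mem ha
  rw [Cycle.chain_coe_cons] at h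
  have h1 := isChain_eq_map_iterate _ _ h
  simp only [List.length_append, List.length_singleton] at h1
  rw [List.range_succ, List.map_append, ← List.cons_append] at h1
  obtain ⟨h2, h3⟩ := List.append_inj' h1 (by simp)
  simp only [List.map_cons, List.map_nil, List.cons.injEq, and_true] at h3
  have hper : Function.IsPeriodicPt f (l.length + 1) a := h3.symm
  have hmem : a ∈ Function.periodicPts f := ⟨l.length + 1, Nat.succ_pos _, hper⟩
  refine ⟨hmem, ?_⟩
  have hmin : Function.minimalPeriod f a = l.length + 1 := by
    refine le_antisymm (hper.minimalPeriod_le (Nat.succ_pos _)) ?_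
    by_contra! hlt
    rw [Cycle.nodup_coe_iff, h2] at hn
    have hinj := List.inj_on_of_nodup_map hn
    have hpos := Function.minimalPeriod_pos_of_mem_periodicPts hmem
    have := hinj (x := 0) (by simp) (y := Function.minimalPeriod f a) (by simp; lia) (by simp)
    lia
  rw [Function.periodicOrbit_def, hmin, ← h2]

end Cycle

/-! ### Counting edges: two cycles force more edges than vertices. -/

namespace WeightedMultigraph

variable {V D : Type*} (G : WeightedMultigraph V D)

theorem rev_injective : Function.Injective G.rev := Function.LeftInverse.injective G.rev_rev

theorem tgt_rev (e : D) : G.tgt (G.rev e) = G.src e := by rw [tgt, G.rev_rev]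

theorem src_rev (e : D) : G.src (G.rev e) = G.tgt e := rfl

/-- Two vertices are joined by an edge in `S`. -/
def Joined (S : Set D) (u v : V) : Prop := ∃ e ∈ S, G.src e = u ∧ G.tgt e = v

/-- A choice of edges leading from every vertex towards `r`, with decreasing heights. -/
theorem exists_spanning_tree {S : Set D} {r : V}
    (h : ∀ v, Relation.ReflTransGen (G.Joined S) v r) :
    ∃ (o : V → D) (d : V → ℕ), ∀ v, v ≠ r →
      o v ∈ S ∧ G.src (o v) = v ∧ d (G.tgt (o v)) < d v := by
  classical
  -- `A n` holds the vertices with a walk of exactly `n` edges of `S` to `r`; the height is the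
  -- least such `n`.
  let A : ℕ → Set V := fun n => Nat.rec (motive := fun _ => Set V) {r}
    (fun _ B => {v | ∃ e ∈ S, G.src e = v ∧ G.tgt e ∈ B}) n
  have hA : ∀ v, ∃ n, v ∈ A n := by
    intro v
    induction h v using Relation.ReflTransGen.head_induction_on with
    | refl => exact ⟨0, rfl⟩
    | head hab _ ih =>
      obtain ⟨n, hn⟩ := ih
      obtain ⟨e, he, h1, h2⟩ := hab
      exact ⟨n + 1, e, he, h1, h2 ▸ hn⟩
  have key : ∀ v, v ≠ r → ∃ e, e ∈ S ∧ G.src e = v ∧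
      Nat.find (hA (G.tgt e)) < Nat.find (hA v) := by
    intro v hv
    have h1 := Nat.find_spec (hA v)
    rcases h2 : Nat.find (hA v) with _ | n
    · rw [h2] at h1
      exact absurd h1 hv
    · rw [h2] at h1
      obtain ⟨e, he, h3, h4⟩ := h1
      exact ⟨e, he, h3, Nat.lt_succ_of_le (Nat.find_min' _ h4)⟩
  choose o ho using key
  by_cases hr : ∃ v, v ≠ r
  · obtain ⟨v₀, hv₀⟩ := hr
    refine ⟨fun v => if hv : v ≠ r then o v hv else o v₀ hv₀, fun v => Nat.find (hA v), ?_⟩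
    intro v hv
    simp only [dif_pos hv]
    exact ho v hv
  · push Not at hr
    by_cases hD : Nonempty D
    · exact ⟨fun _ => hD.some, fun _ => 0, fun v hv => absurd (hr v) hv⟩
    · have : IsEmpty {e : D // G.src e = r} := ⟨fun e => hD ⟨e.1⟩⟩
      have h1 := (G.hasSum_w r).tsum_eq
      rw [tsum_empty] at h1
      exact absurd h1 zero_ne_one

/-- Cycles without backtracking, of distinct oriented edges of any weight. -/
def IsReducedCycle (c : Cycle D) : Prop :=
  c ≠ Cycle.nil ∧ c.Nodup ∧ c.Chain (fun e f => G.tgt e = G.src f ∧ e ≠ G.rev f)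

variable {G}

theorem mem_inv_cycle {c : Cycle D} {e : D} : e ∈ (c.map G.rev).reverse ↔ G.rev e ∈ c := by
  rw [Cycle.mem_reverse_iff, Cycle.mem_map]
  exact ⟨by rintro ⟨f, hf, rfl⟩; rwa [G.rev_rev], fun h => ⟨_, h, G.rev_rev e⟩⟩

theorem IsReducedCycle.inv {c : Cycle D} (h : G.IsReducedCycle c) :
    G.IsReducedCycle (c.map G.rev).reverse := by
  obtain ⟨h1, h2, h3⟩ := h
  refine ⟨?_, ?_, ?_⟩
  · obtain ⟨e, he⟩ := Cycle.ne_nil_iff_exists_mem.1 h1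
    exact Cycle.ne_nil_iff_exists_mem.2 ⟨G.rev e, mem_inv_cycle.2 (by rwa [G.rev_rev])⟩
  · rw [Cycle.nodup_reverse_iff]
    induction c using Quotient.inductionOn with
    | h l =>
      change (l.map G.rev).Nodup
      exact List.Nodup.map G.rev_injective h2
  · apply Cycle.Chain.reverse (r := fun a b => G.tgt b = G.src a ∧ b ≠ G.rev a)
    rw [Cycle.chain_map]
    refine h3.imp ?_
    rintro e f ⟨h4, h5⟩
    rw [tgt_rev, src_rev, G.rev_rev]
    exact ⟨h4.symm, fun h => h5 h.symm⟩

theorem inv_inv_cycle (c : Cycle D) :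
    (((c.map G.rev).reverse).map G.rev).reverse = c := by
  induction c using Quotient.inductionOn with
  | h l =>
    change ((((l.map G.rev).reverse).map G.rev).reverse : Cycle D) = (l : Cycle D)
    simp [Function.comp_def, G.rev_rev]

/-- A cycle lies in a set `F` of edges pointing out of distinct vertices, or its inverse does. -/
theorem IsReducedCycle.subset_or {c : Cycle D} (h : G.IsReducedCycle c) {F : Set D}
    (hF : Set.InjOn G.src F) (hcov : ∀ e, e ∈ F ∨ G.rev e ∈ F) :
    (∀ e ∈ c, e ∈ F) ∨ (∀ e ∈ c, e ∉ F) := by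
  -- If `e ∉ F`, the edge of `F` out of the end of `e` is `rev e`, which a reduced cycle cannot take
  -- next.
  have h1 : c.Chain fun e f => e ∉ F → f ∉ F := by
    refine h.2.2.imp ?_
    rintro e f ⟨h4, h5⟩ he hf
    have h6 := (hcov e).resolve_left he
    have := hF h6 hf h4
    exact h5 (by rw [← this, G.rev_rev])
  rcases h1.forall_or_forall_not with h2 | h2
  · exact Or.inr h2
  · exact Or.inl fun e he => not_not.1 (h2 e he)

/-- Going once round would strictly lower the height. Applied to tree heights, this says that no
cycle follows a spanning tree. -/
theorem IsReducedCycle.not_subset_of_decreasing {c : Cycle D} (h : G.IsReducedCycle c)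
    (d : V → ℕ) : ¬ ∀ e ∈ c, d (G.tgt e) < d (G.src e) := by
  intro hd
  have : IsTrans D (fun e f => d (G.src f) < d (G.src e)) :=
    ⟨fun a b c hab hbc => hbc.trans hab⟩
  have : Std.Irrefl (fun e f : D => d (G.src f) < d (G.src e)) := ⟨fun a => lt_irrefl _⟩
  refine h.1 (Cycle.Chain.eq_nil_of_irrefl (r := fun e f => d (G.src f) < d (G.src e)) ?_)
  have h3 := h.2.2
  induction c using Cycle.induction_on with
  | nil => exact Cycle.Chain.nil _
  | cons a l _ =>
    rw [Cycle.chain_coe_cons] at h3 ⊢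
    have h4 : ∀ e ∈ a :: (l ++ [a]), d (G.tgt e) < d (G.src e) := by
      intro e he
      apply hd
      simpa [or_comm, or_assoc] using he
    refine List.IsChain.imp_of_mem_imp ?_ h3
    intro e f he _ h5
    rw [← h5.1]
    exact h4 e he

/-- Only one edge in the range of `o` leaves each vertex, so the cycle has no choice of
continuation. -/
theorem IsReducedCycle.eq_periodicOrbit {c : Cycle D} (h : G.IsReducedCycle c) {o : V → D}
    (ho : ∀ v, G.src (o v) = v) (hc : ∀ e ∈ c, e ∈ Set.range o) {e : D} (he : e ∈ c) :
    e ∈ Function.periodicPts (fun e => o (G.tgt e)) ∧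
      c = Function.periodicOrbit (fun e => o (G.tgt e)) e := by
  refine Cycle.Chain.eq_periodicOrbit ?_ h.2.1 he
  have h3 := h.2.2
  clear h he
  induction c using Cycle.induction_on with
  | nil => exact Cycle.Chain.nil _
  | cons a l _ =>
    rw [Cycle.chain_coe_cons] at h3 ⊢
    have h4 : ∀ e ∈ a :: (l ++ [a]), e ∈ Set.range o := by
      intro e he
      apply hc
      simpa [or_comm, or_assoc] using he
    refine List.IsChain.imp_of_mem_imp ?_ h3
    intro e f _ hf h5
    obtain ⟨v, rfl⟩ := h4 f hf
    rw [h5.1, ho]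

/-- A reduced cycle in the functional graph of `o` is the only one if the graph is connected. -/
theorem IsReducedCycle.eq_of_subset_range {c₁ c₂ : Cycle D} (h₁ : G.IsReducedCycle c₁)
    (h₂ : G.IsReducedCycle c₂) {o : V → D} (ho : ∀ v, G.src (o v) = v)
    (hcov : ∀ e, e ∈ Set.range o ∨ G.rev e ∈ Set.range o)
    (hconn : ∀ u v, Relation.ReflTransGen (G.Joined Set.univ) u v)
    (hc₁ : ∀ e ∈ c₁, e ∈ Set.range o) (hc₂ : ∀ e ∈ c₂, e ∈ Set.range o) : c₁ = c₂ := by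
  set τ : V → V := fun v => G.tgt (o v) with hτ
  set σ : D → D := fun e => o (G.tgt e) with hσ
  have hστ : ∀ n v, σ^[n] (o v) = o (τ^[n] v) := by
    intro n
    induction n with
    | zero => simp
    | succ n ih => intro v; rw [Function.iterate_succ_apply', Function.iterate_succ_apply', ih]
  -- Up to orientation every edge joins some `x` to `τ x`, so orbits of its ends merge;
  -- connectedness extends this to all pairs.
  have hmerge : ∀ u v, ∃ a b, τ^[a] u = τ^[b] v := by
    intro u v
    induction hconn u v with
    | refl => exact ⟨0, 0, rfl⟩
    | tail _ hbc ih =>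
      obtain ⟨a, b, hab⟩ := ih
      obtain ⟨e, -, rfl, rfl⟩ := hbc
      rcases hcov e with ⟨x, rfl⟩ | ⟨x, hx⟩
      · refine ⟨a + 1, b, ?_⟩
        change _ = τ^[b] (τ x)
        rw [Function.iterate_succ_apply', hab, ho, ← Function.iterate_succ_apply' τ,
          Function.iterate_succ_apply]
      · refine ⟨a, b + 1, ?_⟩
        have h1 : G.tgt e = x := by rw [← src_rev, ← hx, ho]
        have h2 : τ x = G.src e := by rw [← tgt_rev, ← hx]
        rw [hab, Function.iterate_succ_apply, h1, h2]
  obtain ⟨e₁, he₁⟩ := Cycle.ne_nil_iff_exists_mem.1 h₁.1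
  obtain ⟨e₂, he₂⟩ := Cycle.ne_nil_iff_exists_mem.1 h₂.1
  obtain ⟨hp₁, ho₁⟩ := h₁.eq_periodicOrbit ho hc₁ he₁
  obtain ⟨hp₂, ho₂⟩ := h₂.eq_periodicOrbit ho hc₂ he₂
  obtain ⟨u, rfl⟩ := hc₁ _ he₁
  obtain ⟨v, rfl⟩ := hc₂ _ he₂
  obtain ⟨a, b, hab⟩ := hmerge u v
  rw [ho₁, ho₂, ← Function.periodicOrbit_apply_iterate_eq hp₁ a,
    ← Function.periodicOrbit_apply_iterate_eq hp₂ b]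
  change Function.periodicOrbit σ (σ^[a] (o u)) = Function.periodicOrbit σ (σ^[b] (o v))
  rw [hστ, hστ, hab]

/-- A connected graph with two essentially different reduced cycles has more edges than vertices. -/
theorem two_mul_card_lt [Fintype V] [Fintype D]
    (hconn : ∀ u v, Relation.ReflTransGen (G.Joined Set.univ) u v) (htwo : G.TwoCycles) :
    2 * Fintype.card V < Fintype.card D := by
  classical
  by_contra! hcard
  obtain ⟨c₁, c₂, ⟨n1, d1, -, k1⟩, ⟨n2, d2, -, k2⟩, hne, hne'⟩ := htwo
  have h₁ : G.IsReducedCycle c₁ := ⟨n1, d1, k1⟩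
  have h₂ : G.IsReducedCycle c₂ := ⟨n2, d2, k2⟩
  obtain ⟨e₁, he₁⟩ := Cycle.ne_nil_iff_exists_mem.1 h₁.1
  obtain ⟨o₁, d, hd⟩ := G.exists_spanning_tree (fun v => hconn v (G.src e₁))
  set r₁ := G.src e₁
  -- an edge outside the spanning tree
  obtain ⟨a, ha1, ha2⟩ : ∃ a, a ∉ o₁ '' {v | v ≠ r₁} ∧ G.rev a ∉ o₁ '' {v | v ≠ r₁} := by
    by_contra! hcov
    have hcov' : ∀ e, e ∈ o₁ '' {v | v ≠ r₁} ∨ G.rev e ∈ o₁ '' {v | v ≠ r₁} := fun e =>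
      or_iff_not_imp_left.2 (hcov e)
    have hF : Set.InjOn G.src (o₁ '' {v | v ≠ r₁}) := by
      rintro _ ⟨u, hu, rfl⟩ _ ⟨v, hv, rfl⟩ huv
      rw [(hd u hu).2.1, (hd v hv).2.1] at huv
      rw [huv]
    rcases h₁.subset_or hF hcov' with h | h
    · refine h₁.not_subset_of_decreasing d fun e he => ?_
      obtain ⟨v, hv, rfl⟩ := h e he
      rw [(hd v hv).2.1]
      exact (hd v hv).2.2
    · refine h₁.inv.not_subset_of_decreasing d fun e he => ?_
      have h5 := (hcov' (G.rev e)).resolve_left (h _ (mem_inv_cycle.1 he))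
      rw [G.rev_rev] at h5
      obtain ⟨v, hv, rfl⟩ := h5
      rw [(hd v hv).2.1]
      exact (hd v hv).2.2
  -- The graph stays connected without `a`. A spanning tree of the rest, rooted at the start of `a`,
  -- together with `a` itself, has exactly one edge out of every vertex.
  set S : Set D := {e | e ≠ a ∧ e ≠ G.rev a} with hS
  have hsymm : ∀ u v, Relation.ReflTransGen (G.Joined S) u v →
      Relation.ReflTransGen (G.Joined S) v u := by
    intro u v huv
    have : Std.Symm (G.Joined S) := ⟨?_⟩
    · exact Relation.ReflTransGen.stdSymm.symm _ _ huv
    rintro x y ⟨e, he, rfl, rfl⟩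
    refine ⟨G.rev e, ⟨?_, ?_⟩, rfl, tgt_rev G e⟩
    · rintro rfl
      exact he.2 (G.rev_rev e).symm
    · intro h
      exact he.1 (G.rev_injective h)
  have htree : ∀ v, Relation.ReflTransGen (G.Joined S) v r₁ := by
    intro v
    induction hk : d v using Nat.strong_induction_on generalizing v with
    | _ k ih =>
      by_cases hv : v = r₁
      · rw [hv]
      · obtain ⟨-, h2, h3⟩ := hd v hv
        refine Relation.ReflTransGen.head ⟨o₁ v, ⟨?_, ?_⟩, h2, rfl⟩ (ih _ (hk ▸ h3) _ rfl)
        · rintro rfl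
          exact ha1 ⟨v, hv, rfl⟩
        · intro h
          exact ha2 ⟨v, hv, h⟩
  obtain ⟨o₂, d₂, hd₂⟩ := G.exists_spanning_tree
    (fun v => (htree v).trans (hsymm _ _ (htree (G.src a))))
  set o : V → D := fun v => if v = G.src a then a else o₂ v with ho_def
  have ho_root : o (G.src a) = a := if_pos rfl
  have ho_ne : ∀ v, v ≠ G.src a → o v = o₂ v := fun v hv => if_neg hv
  have ho : ∀ v, G.src (o v) = v := by
    intro v
    by_cases hv : v = G.src a
    · rw [hv, ho_root]
    · rw [ho_ne v hv, (hd₂ v hv).2.1]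
  have hdisj : ∀ u v, o u ≠ G.rev (o v) := by
    intro u v huv
    by_cases hu : u = G.src a <;> by_cases hv : v = G.src a
    · rw [hu, hv, ho_root] at huv
      exact G.rev_ne a huv.symm
    · rw [hu, ho_root, ho_ne v hv] at huv
      exact (hd₂ v hv).1.2 (by rw [huv, G.rev_rev])
    · rw [hv, ho_root, ho_ne u hu] at huv
      exact (hd₂ u hu).1.2 huv
    · have h1 := ho u
      have h2 := ho v
      rw [huv, src_rev] at h1
      have h3 : G.tgt (o u) = v := by rw [huv, tgt_rev, h2]
      rw [ho_ne v hv] at h1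
      rw [ho_ne u hu] at h3
      have h4 := (hd₂ u hu).2.2
      have h5 := (hd₂ v hv).2.2
      rw [h1] at h5
      rw [h3] at h4
      lia
  have hcov : ∀ e, e ∈ Set.range o ∨ G.rev e ∈ Set.range o := by
    -- The edges `o v` and their inverses are `2 |V|` distinct elements, so by the assumed bound
    -- they exhaust `D`.
    let φ : V ⊕ V → D := Sum.elim o (fun v => G.rev (o v))
    have hoinj : Function.Injective o := Function.LeftInverse.injective ho
    have hφ : Function.Injective φ :=
      Function.Injective.sumElim hoinj (G.rev_injective.comp hoinj) hdisj
    have hbij := (Fintype.bijective_iff_injective_and_card φ).2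
      ⟨hφ, le_antisymm (Fintype.card_le_of_injective φ hφ) (by simpa [two_mul] using hcard)⟩
    intro e
    obtain ⟨v | v, rfl⟩ := hbij.2 e
    · exact Or.inl ⟨v, rfl⟩
    · exact Or.inr ⟨v, (G.rev_rev _).symm⟩
  have hF : Set.InjOn G.src (Set.range o) := by
    rintro _ ⟨u, rfl⟩ _ ⟨v, rfl⟩ huv
    rw [ho, ho] at huv
    rw [huv]
  have hinv : ∀ c : Cycle D, (∀ e ∈ c, e ∉ Set.range o) →
      ∀ e ∈ (c.map G.rev).reverse, e ∈ Set.range o := by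
    intro c hc e he
    have := (hcov (G.rev e)).resolve_left (hc _ (mem_inv_cycle.1 he))
    rwa [G.rev_rev] at this
  rcases h₁.subset_or hF hcov with s₁ | s₁ <;> rcases h₂.subset_or hF hcov with s₂ | s₂
  · exact hne (h₁.eq_of_subset_range h₂ ho hcov hconn s₁ s₂)
  · exact hne' (h₁.eq_of_subset_range h₂.inv ho hcov hconn s₁ (hinv _ s₂))
  · apply hne'
    rw [← inv_inv_cycle (G := G) c₁,
      h₁.inv.eq_of_subset_range h₂ ho hcov hconn (hinv _ s₁) s₂]
  · apply hne
    rw [← inv_inv_cycle (G := G) c₁, ← inv_inv_cycle (G := G) c₂,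
      h₁.inv.eq_of_subset_range h₂.inv ho hcov hconn (hinv _ s₁) (hinv _ s₂)]

end WeightedMultigraph

/-! ### Balanced edge weights and the stationary measure. -/

namespace WeightedMultigraph

variable {V D : Type*} {G : WeightedMultigraph V D}

theorem joined_of_transition_pos {u v : V} (h : 0 < G.transition u v) :
    Relation.ReflTransGen (G.Joined {e | 0 < G.w e}) u v := by
  classical
  by_cases huv : u = v
  · rw [huv]
  by_contra hne
  have h0 : ∀ e : {e : D // G.src e = u ∧ G.tgt e = v}, G.w e.1 = 0 := by
    rintro ⟨e, he⟩
    by_contra hw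
    exact hne (Relation.ReflTransGen.single ⟨e, lt_of_le_of_ne (G.w_nonneg e) (Ne.symm hw), he⟩)
  simp [transition, huv, h0] at h

theorem reflTransGen_of_isIrreducible (h : G.transition.IsIrreducible) (u v : V) :
    Relation.ReflTransGen (G.Joined {e | 0 < G.w e}) u v := by
  let := Matrix.toQuiver G.transition
  obtain ⟨p, -⟩ := h.connected u v
  induction p with
  | nil => rfl
  | cons _ e ih => exact ih.trans (joined_of_transition_pos e.down)

variable [Fintype D]

open scoped Classical in
theorem sum_w_src (v : V) : (∑ e, if G.src e = v then G.w e else 0) = 1 := by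
  rw [← Finset.sum_filter, ← (G.hasSum_w v).tsum_eq, tsum_fintype]
  exact Finset.sum_subtype _ (by simp) _

variable [Fintype V]

open scoped Classical in
theorem sum_src_eq (f : D → ℝ) (g : V → ℝ) :
    ∑ v, (∑ e, if G.src e = v then f e else 0) * g v = ∑ e, f e * g (G.src e) := by
  simp_rw [Finset.sum_mul]
  rw [Finset.sum_comm]
  refine Finset.sum_congr rfl fun e _ => ?_
  simp [ite_mul]

open scoped Classical in
/-- On a connected graph there is a flow with any given divergence of total mass zero. -/
theorem exists_flow (hconn : ∀ u v, Relation.ReflTransGen (G.Joined Set.univ) u v)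
    (a : V → ℝ) (ha : ∑ v, a v = 0) :
    ∃ φ : D → ℝ, (∀ e, φ (G.rev e) = -φ e) ∧
      ∀ v, (∑ e, if G.src e = v then φ e else 0) = a v := by
  let W : Submodule ℝ (V → ℝ) :=
    { carrier := {a | ∃ φ : D → ℝ, (∀ e, φ (G.rev e) = -φ e) ∧
        ∀ v, (∑ e, if G.src e = v then φ e else 0) = a v}
      zero_mem' := ⟨0, by simp, by simp⟩
      add_mem' := by
        rintro a b ⟨φ, h1, h2⟩ ⟨ψ, h3, h4⟩
        refine ⟨φ + ψ, fun e => by simp [h1, h3, add_comm], fun v => ?_⟩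
        rw [Pi.add_apply, ← h2, ← h4, ← Finset.sum_add_distrib]
        refine Finset.sum_congr rfl fun e _ => ?_
        split_ifs <;> simp
      smul_mem' := by
        rintro c a ⟨φ, h1, h2⟩
        refine ⟨c • φ, fun e => by simp [h1], fun v => ?_⟩
        rw [Pi.smul_apply, ← h2, smul_eq_mul, Finset.mul_sum]
        refine Finset.sum_congr rfl fun e _ => ?_
        split_ifs <;> simp }
  -- Send a unit flow along a path from `u` to `v`; these differences span the functions of total
  -- mass zero.
  have hW : ∀ u v, Pi.single u (1 : ℝ) - Pi.single v 1 ∈ W := by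
    intro u v
    induction hconn u v with
    | refl => simp
    | @tail b c _ hbc ih =>
      suffices Pi.single b (1 : ℝ) - Pi.single c 1 ∈ W by simpa using W.add_mem ih this
      obtain ⟨d, -, rfl, rfl⟩ := hbc
      refine ⟨Pi.single d 1 - Pi.single (G.rev d) 1, fun e => ?_, fun v => ?_⟩
      · have h1 : G.rev e = d ↔ e = G.rev d :=
          ⟨fun h => by rw [← h, G.rev_rev], fun h => by rw [h, G.rev_rev]⟩
        have h2 : G.rev e = G.rev d ↔ e = d := G.rev_injective.eq_iff
        simp [Pi.single_apply, h1, h2]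
      · have h3 : ∀ e, (if G.src e = v then (Pi.single d 1 - Pi.single (G.rev d) 1 : D → ℝ) e else 0)
            = (if e = d then (if G.src e = v then 1 else 0) else 0)
              - (if e = G.rev d then (if G.src e = v then 1 else 0) else 0) := by
          intro e
          simp only [Pi.sub_apply, Pi.single_apply]
          split_ifs <;> simp
        rw [Finset.sum_congr rfl fun e _ => h3 e, Finset.sum_sub_distrib, Finset.sum_ite_eq',
          Finset.sum_ite_eq']
        simp [Pi.single_apply, src_rev, eq_comm]
  suffices a ∈ W from this
  by_cases hV : Nonempty V
  · obtain ⟨r⟩ := hV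
    have : a = ∑ u, a u • (Pi.single u (1 : ℝ) - Pi.single r 1) := by
      simp_rw [smul_sub]
      rw [Finset.sum_sub_distrib, ← Finset.sum_smul, ha, zero_smul, sub_zero]
      ext v
      simp [Finset.sum_apply, Pi.single_apply]
    rw [this]
    exact W.sum_mem fun u _ => W.smul_mem _ (hW u r)
  · have : a = 0 := funext fun v => absurd ⟨v⟩ hV
    rw [this]
    exact W.zero_mem

open scoped Classical in
/-- If the graph has more edges than vertices, there are weights `θ` whose total mass out of every
vertex exceeds by one the total mass of every edge. -/
theorem exists_expanding_weights (hconn : ∀ u v, Relation.ReflTransGen (G.Joined Set.univ) u v)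
    (hcard : 2 * Fintype.card V < Fintype.card D) :
    ∃ (θ : D → ℝ) (s : ℝ), 0 ≤ s ∧ (∀ e, θ e + θ (G.rev e) = s) ∧
      ∀ v, (∑ e, if G.src e = v then θ e else 0) = s + 1 := by
  have hpos : (0 : ℝ) < Fintype.card D - 2 * Fintype.card V := by
    have : ((2 * Fintype.card V : ℕ) : ℝ) < Fintype.card D := by exact_mod_cast hcard
    push_cast at this
    linarith
  -- Solves `|V| (s + 1) = |D| s / 2`: constant weights `s / 2` then have the right total mass, and
  -- an antisymmetric flow redistributes it.
  set s : ℝ := 2 * Fintype.card V / (Fintype.card D - 2 * Fintype.card V) with hs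
  have hdeg : ∑ v, (∑ e, if G.src e = v then s / 2 else 0) = Fintype.card D * (s / 2) := by
    have := G.sum_src_eq (fun _ => s / 2) (fun _ => 1)
    simpa using this
  obtain ⟨φ, h1, h2⟩ := exists_flow hconn
    (fun v => s + 1 - ∑ e, if G.src e = v then s / 2 else 0) (by
      rw [Finset.sum_sub_distrib, hdeg]
      simp only [Finset.sum_const, Finset.card_univ, nsmul_eq_mul]
      have hs' : s * (Fintype.card D - 2 * Fintype.card V) = 2 * Fintype.card V :=
        div_mul_cancel₀ _ hpos.ne'
      linear_combination (-1 / 2) * hs')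
  refine ⟨fun e => s / 2 + φ e, s, by positivity, fun e => ?_, fun v => ?_⟩
  · simp only [h1]
    ring
  · have h3 : ∀ e, (if G.src e = v then s / 2 + φ e else 0)
        = (if G.src e = v then s / 2 else 0) + if G.src e = v then φ e else 0 := by
      intro e
      split_ifs <;> simp
    simp only [h3, Finset.sum_add_distrib, h2]
    ring

open scoped Classical in
/-- A finite irreducible walk has a positive stationary measure. -/
theorem exists_stationary [Nonempty V]
    (hconn : ∀ u v, Relation.ReflTransGen (G.Joined {e | 0 < G.w e}) u v) :
    ∃ π : V → ℝ, (∀ v, 0 < π v) ∧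
      ∀ v, (∑ e, if G.tgt e = v then π (G.src e) * G.w e else 0) = π v := by
  let A : (V → ℝ) →ₗ[ℝ] (V → ℝ) :=
    { toFun := fun π v => ∑ e, if G.tgt e = v then π (G.src e) * G.w e else 0
      map_add' := by
        intro π π'
        ext v
        rw [Pi.add_apply, ← Finset.sum_add_distrib]
        refine Finset.sum_congr rfl fun e _ => ?_
        split_ifs
        · simp [add_mul]
        · simp
      map_smul' := by
        intro c π
        ext v
        rw [Pi.smul_apply, smul_eq_mul, Finset.mul_sum]
        refine Finset.sum_congr rfl fun e _ => ?_
        split_ifs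
        · simp [mul_assoc]
        · simp }
  have hA : ∀ π v, A π v = ∑ e, if G.tgt e = v then π (G.src e) * G.w e else 0 := fun _ _ => rfl
  have hsum : ∀ π, ∑ v, A π v = ∑ v, π v := by
    intro π
    simp_rw [hA]
    rw [Finset.sum_comm]
    have h1 := G.sum_src_eq (fun e => G.w e) π
    simp_rw [sum_w_src, one_mul] at h1
    rw [h1]
    refine Finset.sum_congr rfl fun e _ => ?_
    simp [mul_comm]
  -- `A` preserves total mass, so the image of `A - id` has mass zero; not being surjective, it is
  -- not injective.
  obtain ⟨μ, hμ0, hμ⟩ : ∃ μ : V → ℝ, μ ≠ 0 ∧ A μ = μ := by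
    by_contra! hcon
    have hinj : Function.Injective (A - LinearMap.id : (V → ℝ) →ₗ[ℝ] (V → ℝ)) := by
      rw [← LinearMap.ker_eq_bot, LinearMap.ker_eq_bot']
      intro μ hμ
      by_contra h0
      exact hcon μ h0 (sub_eq_zero.1 (by simpa using hμ))
    obtain ⟨r⟩ := ‹Nonempty V›
    obtain ⟨μ, hμ⟩ := LinearMap.injective_iff_surjective.1 hinj (Pi.single r 1)
    have h1 : ∑ v, (A - LinearMap.id : (V → ℝ) →ₗ[ℝ] (V → ℝ)) μ v = 1 := by
      rw [hμ]
      simp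
    simp [hsum] at h1
  have hle : ∀ v, |μ v| ≤ A (fun v => |μ v|) v := by
    intro v
    conv_lhs => rw [← hμ, hA]
    refine (Finset.abs_sum_le_sum_abs _ _).trans (le_of_eq (Finset.sum_congr rfl fun e _ => ?_))
    split_ifs
    · rw [abs_mul, abs_of_nonneg (G.w_nonneg e)]
    · simp
  -- A pointwise inequality between functions of equal total mass is an equality.
  have heq : ∀ v, A (fun v => |μ v|) v = |μ v| := by
    intro v
    exact ((Finset.sum_eq_sum_iff_of_le fun v _ => hle v).1 (hsum _).symm v (Finset.mem_univ v)).symm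
  obtain ⟨u, hu⟩ : ∃ u, 0 < |μ u| := by
    obtain ⟨u, hu⟩ := Function.ne_iff.1 hμ0
    exact ⟨u, abs_pos.2 hu⟩
  refine ⟨fun v => |μ v|, fun v => ?_, heq⟩
  induction hconn u v with
  | refl => exact hu
  | tail _ hbc ih =>
    obtain ⟨e, he, rfl, rfl⟩ := hbc
    have he' : 0 < G.w e := he
    change 0 < |μ (G.tgt e)|
    rw [← heq, hA]
    refine Finset.sum_pos' (fun f _ => ?_) ⟨e, Finset.mem_univ e, ?_⟩
    · have := G.w_nonneg f
      split_ifs <;> positivity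
    · rw [if_pos rfl]
      exact mul_pos ih he'

end WeightedMultigraph

/-! ### A spectral gap on the universal cover. -/

namespace WeightedMultigraph

/-- Jensen bounds the square of the mean of `b`; the gradient term is the gain from laziness, and
makes reversibility unnecessary. -/
theorem sq_convex_comb_le {ι : Type*} [Fintype ι] (p b : ι → ℝ) (a : ℝ) (hp : ∀ i, 0 ≤ p i)
    (h1 : ∑ i, p i = 1) :
    (1 / 2 * a + 1 / 2 * ∑ i, p i * b i) ^ 2 ≤
      1 / 2 * a ^ 2 + 1 / 2 * ∑ i, p i * b i ^ 2 - 1 / 4 * ∑ i, p i * (b i - a) ^ 2 := by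
  have h2 : (∑ i, p i * b i) ^ 2 ≤ ∑ i, p i * b i ^ 2 := by
    simpa using (even_two.convexOn_pow (𝕜 := ℝ)).map_sum_le (t := Finset.univ) (w := p) (p := b)
      (fun i _ => hp i) h1 (fun i _ => Set.mem_univ _)
  have h3 : ∑ i, p i * (b i - a) ^ 2
      = ∑ i, p i * b i ^ 2 - 2 * a * ∑ i, p i * b i + a ^ 2 := by
    rw [← mul_one (a ^ 2), ← h1, Finset.mul_sum, Finset.mul_sum, ← Finset.sum_sub_distrib,
      ← Finset.sum_add_distrib]
    exact Finset.sum_congr rfl fun i _ => by ring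
  rw [h3]
  nlinarith

variable {V D : Type*} {G : WeightedMultigraph V D} {v : V}

variable (G v) in
/-- Reversal of the oriented edges of the universal cover. -/
noncomputable def revEquiv : G.CoverEdge v ≃ G.CoverEdge v :=
  (Function.Involutive.toPerm (G.universalCover v).rev (G.universalCover v).rev_rev)

theorem revEquiv_src (d : G.CoverEdge v) : (G.revEquiv v d).1.1 = d.tip := rfl

theorem revEquiv_label (d : G.CoverEdge v) : (G.revEquiv v d).1.2 = G.rev d.1.2 := rfl

theorem revEquiv_tip (d : G.CoverEdge v) : (G.revEquiv v d).tip = d.1.1 := d.tip_rev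

variable (G v) in
/-- The oriented edges of the universal cover, sorted by initial vertex. -/
def sigmaEquiv : (Σ z : G.CoverVertex v, {e : D // G.src e = z.label}) ≃ G.CoverEdge v where
  toFun p := ⟨(p.1, p.2.1), p.2.2⟩
  invFun d := ⟨d.1.1, ⟨d.1.2, d.2⟩⟩
  left_inv _ := rfl
  right_inv _ := rfl

section Summability

variable [Fintype D]

noncomputable instance fintypeSrc (u : V) : Fintype {e : D // G.src e = u} :=
  Fintype.ofFinite _

theorem hasSum_coverEdge {F : G.CoverEdge v → ℝ} (hF : Summable F) :
    HasSum (fun z : G.CoverVertex v => ∑ e : {e : D // G.src e = z.label}, F ⟨(z, e.1), e.2⟩)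
      (∑' d, F d) := by
  have h1 := (G.sigmaEquiv v).hasSum_iff.2 hF.hasSum
  exact h1.sigma fun z => hasSum_fintype _

theorem summable_src {f : G.CoverVertex v → ℝ} (hf : Summable f) (h0 : ∀ x, 0 ≤ f x) :
    Summable fun d : G.CoverEdge v => f d.1.1 := by
  have h1 : Summable fun p : G.CoverVertex v × D => f p.1 * (fun _ : D => (1 : ℝ)) p.2 :=
    hf.mul_of_nonneg (Summable.of_finite) h0 (fun _ => zero_le_one)
  simp only [mul_one] at h1
  exact h1.subtype _

theorem summable_tip {f : G.CoverVertex v → ℝ} (hf : Summable f) (h0 : ∀ x, 0 ≤ f x) :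
    Summable fun d : G.CoverEdge v => f d.tip :=
  (G.revEquiv v).summable_iff.2 (summable_src hf h0)

theorem summable_bounded_mul {ι : Type*} {f c : ι → ℝ} (hf : Summable f) (h0 : ∀ i, 0 ≤ f i) {K : ℝ}
    (hc : ∀ i, |c i| ≤ K) : Summable fun i => c i * f i := by
  refine Summable.of_norm_bounded (hf.mul_left K) fun i => ?_
  rw [Real.norm_eq_abs, abs_mul, abs_of_nonneg (h0 i)]
  exact mul_le_mul_of_nonneg_right (hc i) (h0 i)

theorem summable_gradient {g : G.CoverVertex v → ℝ} (hg : Summable fun x => g x ^ 2) :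
    Summable fun d : G.CoverEdge v => (g d.1.1 - g d.tip) ^ 2 := by
  have h1 := summable_src hg (fun x => sq_nonneg _)
  have h2 := summable_tip hg (fun x => sq_nonneg _)
  refine Summable.of_nonneg_of_le (fun d => sq_nonneg _) (fun d => ?_)
    ((h1.mul_left 2).add (h2.mul_left 2))
  nlinarith [sq_nonneg (g d.1.1 + g d.tip)]

end Summability

open scoped Classical in
/-- The weights `θ` on the edges pointing away from the root, extended antisymmetrically. -/
noncomputable def coverFlow (θ : D → ℝ) (d : G.CoverEdge v) : ℝ :=
  if d.1.1.path.head? = some (G.rev d.1.2) then -θ (G.rev d.1.2) else θ d.1.2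

/-- Exactly one of an edge and its inverse points towards the root: after a cancellation, the
absence of backtracking keeps the new last edge from being `e`. -/
theorem head?_extendPath (x : G.CoverVertex v) (e : D) :
    (G.extendPath e x.path).head? = some e ↔ x.path.head? ≠ some (G.rev e) := by
  obtain ⟨p, a, hp, hn⟩ := x
  cases p with
  | nil => simp [extendPath]
  | cons f p =>
    by_cases h : f = G.rev e
    · subst h
      cases p with
      | nil => simp [extendPath]
      | cons g p =>
        have hg : g ≠ e := fun h' => (List.isChain_cons_cons.1 hn).1 (by rw [h'])
        simp [extendPath, hg]
    · simp [extendPath, h]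

theorem coverFlow_rev (θ : D → ℝ) (d : G.CoverEdge v) :
    coverFlow θ (G.revEquiv v d) = -coverFlow θ d := by
  have h1 : (G.revEquiv v d).1.1.path.head? = some (G.rev (G.revEquiv v d).1.2) ↔
      d.1.1.path.head? ≠ some (G.rev d.1.2) := by
    rw [revEquiv_label, G.rev_rev]
    exact head?_extendPath d.1.1 d.1.2
  by_cases h : d.1.1.path.head? = some (G.rev d.1.2)
  · rw [coverFlow, coverFlow, if_pos h, if_neg (fun h2 => h1.1 h2 h), revEquiv_label, neg_neg]
  · rw [coverFlow, coverFlow, if_neg h, if_pos (h1.2 h), revEquiv_label, G.rev_rev]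

theorem abs_coverFlow_le {θ : D → ℝ} {K : ℝ} (hK : ∀ e, |θ e| ≤ K) (d : G.CoverEdge v) :
    |coverFlow θ d| ≤ K := by
  unfold coverFlow
  split_ifs
  · rw [abs_neg]
    exact hK _
  · exact hK _

variable [Fintype D]

open scoped Classical in
theorem sum_fintypeSrc (u : V) (f : D → ℝ) :
    ∑ e : {e : D // G.src e = u}, f e.1 = ∑ e, if G.src e = u then f e else 0 := by
  rw [← Finset.sum_filter]
  exact (Finset.sum_subtype _ (by simp) _).symm

open scoped Classical in
/-- The divergence of the extended weights is at least one everywhere. -/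
theorem one_le_sum_coverFlow {θ : D → ℝ} {s : ℝ} (hs : 0 ≤ s)
    (h1 : ∀ e, θ e + θ (G.rev e) = s)
    (h2 : ∀ v, (∑ e, if G.src e = v then θ e else 0) = s + 1) (z : G.CoverVertex v) :
    1 ≤ ∑ e : {e : D // G.src e = z.label}, coverFlow θ (⟨(z, e.1), e.2⟩ : G.CoverEdge v) := by
  -- An edge towards the root carries `-θ (rev e) = θ e - s`. At most one edge out of `z` does so,
  -- so at most `s` of the mass `s + 1` is lost.
  have h3 : ∀ e : {e : D // G.src e = z.label},
      coverFlow θ (⟨(z, e.1), e.2⟩ : G.CoverEdge v) =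
        θ e.1 - if z.path.head? = some (G.rev e.1) then s else 0 := by
    intro e
    unfold coverFlow
    split_ifs
    · linarith [h1 e.1]
    · simp
  have h4 : ∑ e : {e : D // G.src e = z.label},
      (if z.path.head? = some (G.rev e.1) then s else 0) ≤ s := by
    rw [← Finset.sum_filter, Finset.sum_const, nsmul_eq_mul]
    have h5 : ((Finset.univ.filter fun e : {e : D // G.src e = z.label} =>
        z.path.head? = some (G.rev e.1)).card : ℝ) ≤ 1 := by
      rw [← Nat.cast_one, Nat.cast_le]
      refine Finset.card_le_one.2 fun a ha b hb => ?_
      simp only [Finset.mem_filter, Finset.mem_univ, true_and] at ha hb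
      rw [ha] at hb
      exact Subtype.ext (G.rev_injective (Option.some_injective _ hb))
    nlinarith
  rw [Finset.sum_congr rfl fun e _ => h3 e, Finset.sum_sub_distrib, sum_fintypeSrc z.label θ, h2]
  linarith

/-- The isoperimetric inequality of the universal cover, in the form of a spectral gap. -/
theorem exists_poincare {θ : D → ℝ} {s : ℝ} (hs : 0 ≤ s)
    (h1 : ∀ e, θ e + θ (G.rev e) = s) (h2 : open scoped Classical in
      ∀ v, (∑ e, if G.src e = v then θ e else 0) = s + 1) :
    ∃ C > 0, ∀ (v : V) (g : G.CoverVertex v → ℝ), (Summable fun x => g x ^ 2) →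
      ∑' x, g x ^ 2 ≤ C * ∑' d : G.CoverEdge v, (g d.1.1 - g d.tip) ^ 2 := by
  obtain ⟨K, hK0, hK⟩ : ∃ K > 0, ∀ e, |θ e| ≤ K :=
    ⟨∑ e, |θ e| + 1, by positivity, fun e => (Finset.single_le_sum (f := fun e => |θ e|)
      (fun _ _ => abs_nonneg _) (Finset.mem_univ e)).trans (by linarith)⟩
  set n : ℝ := Fintype.card D + 1 with hn
  have hn0 : 0 < n := by positivity
  refine ⟨K ^ 2 * n, by positivity, fun v g hg => ?_⟩
  set h : G.CoverEdge v → ℝ := coverFlow θ with hh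
  have hhK : ∀ d, |h d| ≤ K := abs_coverFlow_le hK
  have sS := summable_src hg (fun x => sq_nonneg _)
  have sT := summable_tip hg (fun x => sq_nonneg _)
  have sN := summable_gradient hg
  have shS := summable_bounded_mul sS (fun d => sq_nonneg _) hhK
  have shT := summable_bounded_mul sT (fun d => sq_nonneg _) hhK
  have e1 : ∑' x, g x ^ 2 ≤ ∑' d, h d * g d.1.1 ^ 2 := by
    have h3 := hasSum_coverEdge shS
    refine hasSum_le (fun z => ?_) hg.hasSum h3
    change _ ≤ ∑ e : {e : D // G.src e = z.label}, h ⟨(z, e.1), e.2⟩ * g z ^ 2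
    rw [← Finset.sum_mul]
    have := one_le_sum_coverFlow (v := v) hs h1 h2 z
    exact le_mul_of_one_le_left (sq_nonneg _) this
  -- Antisymmetry of `h` under edge reversal: the left side of `e5` becomes twice the sum bounded
  -- below in `e1`.
  have e2 : ∑' d, h d * g d.tip ^ 2 = -∑' d, h d * g d.1.1 ^ 2 := by
    rw [← (G.revEquiv v).tsum_eq, ← tsum_neg]
    refine tsum_congr fun d => ?_
    rw [revEquiv_tip, hh, coverFlow_rev, neg_mul]
  have e3 : ∑' d : G.CoverEdge v, g d.tip ^ 2 = ∑' d : G.CoverEdge v, g d.1.1 ^ 2 :=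
    (G.revEquiv v).tsum_eq (fun d => g d.1.1 ^ 2)
  have e4 : ∑' d : G.CoverEdge v, g d.1.1 ^ 2 ≤ n * ∑' x, g x ^ 2 := by
    refine hasSum_le (fun z => ?_) (hasSum_coverEdge sS) (hg.hasSum.mul_left n)
    change ∑ _e : {e : D // G.src e = z.label}, g z ^ 2 ≤ _
    rw [Finset.sum_const, nsmul_eq_mul]
    refine mul_le_mul_of_nonneg_right ?_ (sq_nonneg _)
    rw [Finset.card_univ, hn]
    have : Fintype.card {e : D // G.src e = z.label} ≤ Fintype.card D :=
      Fintype.card_subtype_le _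
    have : (Fintype.card {e : D // G.src e = z.label} : ℝ) ≤ Fintype.card D := by exact_mod_cast this
    linarith
  -- Factor the difference of squares and apply AM-GM. The factor `1 / (2 * n)` makes the last sum
  -- at most `∑ g ^ 2`, absorbed by the `2 ∑ g ^ 2` on the left.
  have e5 : ∑' d, (h d * g d.1.1 ^ 2 - h d * g d.tip ^ 2) ≤
      ∑' d : G.CoverEdge v, (K ^ 2 * n * (g d.1.1 - g d.tip) ^ 2 +
        1 / (2 * n) * (g d.1.1 ^ 2 + g d.tip ^ 2)) := by
    refine (shS.sub shT).tsum_le_tsum (fun d => ?_)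
      ((sN.mul_left _).add ((sS.add sT).mul_left _))
    have h3 : h d ^ 2 ≤ K ^ 2 := sq_le_sq' (abs_le.1 (hhK d)).1 (abs_le.1 (hhK d)).2
    set x := g d.1.1
    set y := g d.tip
    have h4 : h d ^ 2 * (n * (x - y) ^ 2) ≤ K ^ 2 * (n * (x - y) ^ 2) :=
      mul_le_mul_of_nonneg_right h3 (by positivity)
    have h5 : 1 / (2 * n) * (x ^ 2 + y ^ 2) - (h d * x ^ 2 - h d * y ^ 2) + h d ^ 2 * (n * (x - y) ^ 2)
        = 1 / n * (1 / 2 * (x + y) - n * h d * (x - y)) ^ 2 + 1 / (4 * n) * (x - y) ^ 2 := by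
      field_simp
      ring
    have h6 : 0 ≤ 1 / n * (1 / 2 * (x + y) - n * h d * (x - y)) ^ 2 + 1 / (4 * n) * (x - y) ^ 2 := by
      positivity
    linarith
  rw [shS.tsum_sub shT, (sN.mul_left _).tsum_add ((sS.add sT).mul_left _), tsum_mul_left,
    tsum_mul_left, sS.tsum_add sT, e2, e3] at e5
  have e6 : 1 / (2 * n) * (∑' d : G.CoverEdge v, g d.1.1 ^ 2 + ∑' d : G.CoverEdge v, g d.1.1 ^ 2)
      ≤ ∑' x, g x ^ 2 := by
    rw [← two_mul, div_mul_eq_mul_div, one_mul, mul_div_mul_left _ _ two_ne_zero,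
      div_le_iff₀ hn0, mul_comm]
    exact e4
  linarith

end WeightedMultigraph

/-! ### Contraction in `L²` and decay of transition probabilities. -/

namespace WeightedMultigraph

variable {V D : Type*} {G : WeightedMultigraph V D} {v : V}

/-- The oriented edges of the universal cover from `x` to `z`, by their inverses. -/
noncomputable def edgesBetweenEquiv (x z : G.CoverVertex v) :
    {d : G.CoverEdge v // (G.universalCover v).src d = x ∧ (G.universalCover v).tgt d = z} ≃
      {e : {e : D // G.src e = z.label} // z.step e.1 e.2 = x} where
  toFun d := ⟨⟨G.rev d.1.1.2, congrArg CoverVertex.label d.2.2⟩, by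
    obtain ⟨d, rfl, rfl⟩ := d
    exact d.tip_rev⟩
  invFun e := ⟨(G.universalCover v).rev ⟨(z, e.1.1), e.1.2⟩, e.2,
    CoverEdge.tip_rev ⟨(z, e.1.1), e.1.2⟩⟩
  left_inv d := by
    obtain ⟨d, rfl, rfl⟩ := d
    exact Subtype.ext ((G.universalCover v).rev_rev d)
  right_inv e := Subtype.ext (Subtype.ext (G.rev_rev _))

variable [Fintype D]

open scoped Classical in
theorem transition_universalCover (x z : G.CoverVertex v) :
    (G.universalCover v).transition x z = 1 / 2 * (if x = z then 1 else 0) +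
      1 / 2 * ∑ e : {e : D // G.src e = z.label},
        if x = z.step e.1 e.2 then G.w (G.rev e.1) else 0 := by
  rw [transition]
  congr 2
  rw [← (edgesBetweenEquiv x z).symm.tsum_eq, tsum_fintype, ← Finset.sum_filter]
  refine (Finset.sum_subtype (p := fun e : {e : D // G.src e = z.label} => z.step e.1 e.2 = x)
    _ (by simp [eq_comm]) (fun e => G.w (G.rev e.1))).symm

/-- One step of the walk on the universal cover, acting on the distribution of the position. -/
noncomputable def evolve (a : G.CoverVertex v → ℝ) (z : G.CoverVertex v) : ℝ :=
  1 / 2 * a z +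
    1 / 2 * ∑ e : {e : D // G.src e = z.label}, G.w (G.rev e.1) * a (z.step e.1 e.2)

/-- Only `z` and its finitely many neighbours contribute, so `a` may be arbitrary. -/
theorem hasSum_mul_transition (a : G.CoverVertex v → ℝ) (z : G.CoverVertex v) :
    HasSum (fun x => a x * (G.universalCover v).transition x z) (evolve a z) := by
  classical
  have h0 : ∀ (y : G.CoverVertex v) (b : G.CoverVertex v → ℝ),
      HasSum (fun x => if x = y then b x else 0) (b y) := by
    intro y b
    have := hasSum_single (f := fun x => if x = y then b x else 0) y fun x hx => if_neg hx
    simpa using this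
  have h1 := ((h0 z a).mul_left (1 / 2)).add ((hasSum_sum (s := Finset.univ)
    fun (e : {e : D // G.src e = z.label}) _ =>
      h0 (z.step e.1 e.2) fun x => G.w (G.rev e.1) * a x).mul_left (1 / 2))
  refine HasSum.congr_fun h1 ?_
  intro x
  rw [transition_universalCover, mul_add, mul_left_comm, mul_left_comm (a x), Finset.mul_sum]
  congr 2
  · simp
  · refine Finset.sum_congr rfl fun e _ => ?_
    split_ifs
    · exact mul_comm _ _
    · simp

theorem exists_pos_forall_le {ι : Type*} [Finite ι] {f : ι → ℝ} (hf : ∀ i, 0 < f i) :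
    ∃ c > 0, ∀ i, c ≤ f i := by
  rcases isEmpty_or_nonempty ι with h | h
  · exact ⟨1, one_pos, fun i => h.elim i⟩
  · obtain ⟨i, hi⟩ := Finite.exists_min f
    exact ⟨f i, hf i, hi⟩

theorem exists_pos_forall_ge {ι : Type*} [Finite ι] (f : ι → ℝ) :
    ∃ c > 0, ∀ i, f i ≤ c := by
  rcases isEmpty_or_nonempty ι with h | h
  · exact ⟨1, one_pos, fun i => h.elim i⟩
  · obtain ⟨i, hi⟩ := Finite.exists_max f
    exact ⟨|f i| + 1, by positivity, fun j => (hi j).trans ((le_abs_self _).trans (by linarith))⟩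

/-- The walk contracts the `L²` norm with respect to the lifted stationary measure. -/
theorem exists_contraction [Finite V] {π : V → ℝ} (hπ : ∀ v, 0 < π v)
    (hstat : open scoped Classical in
      ∀ v, (∑ e, if G.tgt e = v then π (G.src e) * G.w e else 0) = π v)
    (hP : ∃ C > 0, ∀ (v : V) (g : G.CoverVertex v → ℝ), (Summable fun x => g x ^ 2) →
      ∑' x, g x ^ 2 ≤ C * ∑' d : G.CoverEdge v, (g d.1.1 - g d.tip) ^ 2) :
    ∃ ρ, 0 < ρ ∧ ρ < 1 ∧ ∀ (v : V) (a : G.CoverVertex v → ℝ),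
      (Summable fun x => a x ^ 2 / π x.label) →
      (Summable fun x => evolve a x ^ 2 / π x.label) ∧
        ∑' x, evolve a x ^ 2 / π x.label ≤ ρ * ∑' x, a x ^ 2 / π x.label := by
  classical
  obtain ⟨C, hC0, hC⟩ := hP
  -- Symmetrised conductances are positive even on edges that the walk crosses in one direction
  -- only.
  obtain ⟨c, hc0, hc⟩ : ∃ c > 0, ∀ e, c ≤ π (G.tgt e) * G.w (G.rev e) + π (G.src e) * G.w e := by
    refine exists_pos_forall_le fun e => ?_
    have h1 := G.w_nonneg e
    have h2 := G.w_nonneg (G.rev e)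
    have h3 := hπ (G.src e)
    have h4 := hπ (G.tgt e)
    rcases G.w_pos_or e with h | h
    · exact add_pos_of_nonneg_of_pos (by positivity) (by positivity)
    · exact add_pos_of_pos_of_nonneg (by positivity) (by positivity)
  obtain ⟨M, hM0, hM⟩ := exists_pos_forall_ge π
  obtain ⟨B, hB0, hB⟩ := exists_pos_forall_ge (fun e => π (G.src e) * G.w e)
  -- The first term is what `e3`, `e4` and the spectral gap allow in `hnum`; the second keeps `1 -
  -- δ` positive.
  set δ : ℝ := min (c / (8 * C * M)) (1 / 2) with hδ
  have hδ0 : 0 < δ := lt_min (by positivity) (by norm_num)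
  have hδ1 : δ ≤ 1 / 2 := min_le_right _ _
  refine ⟨1 - δ, by linarith, by linarith, fun v a ha => ?_⟩
  set g : G.CoverVertex v → ℝ := fun x => a x / π x.label with hg
  have hag : ∀ x, a x = π x.label * g x := fun x => by
    rw [hg, mul_div_cancel₀ _ (hπ _).ne']
  have hmg : ∀ x, a x ^ 2 / π x.label = π x.label * g x ^ 2 := fun x => by
    rw [hag]
    have := (hπ x.label).ne'
    field_simp
  simp only [hmg] at ha ⊢
  obtain ⟨c', hc'0, hc'⟩ := exists_pos_forall_le hπ
  have sg : Summable fun x => g x ^ 2 := by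
    refine Summable.of_nonneg_of_le (fun x => sq_nonneg _) (fun x => ?_) (ha.mul_left c'⁻¹)
    rw [← mul_assoc]
    refine le_mul_of_one_le_left (sq_nonneg _) ?_
    rw [inv_mul_eq_div, one_le_div hc'0]
    exact hc' _
  have sS := summable_src sg (fun x => sq_nonneg _)
  have sT := summable_tip sg (fun x => sq_nonneg _)
  have sN := summable_gradient sg
  set W : G.CoverEdge v → ℝ := fun d => π (G.tgt d.1.2) * G.w (G.rev d.1.2) with hW
  set W' : G.CoverEdge v → ℝ := fun d => π (G.src d.1.2) * G.w d.1.2 with hW'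
  have hWrev : ∀ d, W (G.revEquiv v d) = W' d := fun d => by
    simp only [hW, hW', revEquiv_label, tgt_rev, G.rev_rev]
  have hW'0 : ∀ d, 0 ≤ W' d := fun d => mul_nonneg (hπ _).le (G.w_nonneg _)
  have hW'B : ∀ d, |W' d| ≤ B := fun d => by
    rw [abs_of_nonneg (hW'0 d)]
    exact hB d.1.2
  have hW0 : ∀ d, 0 ≤ W d := fun d => mul_nonneg (hπ _).le (G.w_nonneg _)
  have hWB : ∀ d, |W d| ≤ B := fun d => by
    rw [abs_of_nonneg (hW0 d)]
    exact hB (G.rev d.1.2)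
  have sWT := summable_bounded_mul sT (fun d => sq_nonneg _) hWB
  have sWN := summable_bounded_mul sN (fun d => sq_nonneg _) hWB
  have sW'N := summable_bounded_mul sN (fun d => sq_nonneg _) hW'B
  have sW'S := summable_bounded_mul sS (fun d => sq_nonneg _) hW'B
  have e1 : ∑' d, W d * g d.tip ^ 2 = ∑' x, π x.label * g x ^ 2 := by
    rw [← (G.revEquiv v).tsum_eq]
    simp only [hWrev, revEquiv_tip]
    have hfun : ∀ z : G.CoverVertex v, ∑ e : {e : D // G.src e = z.label},
        W' ⟨(z, e.1), e.2⟩ * g z ^ 2 = π z.label * g z ^ 2 := by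
      intro z
      rw [← Finset.sum_mul]
      congr 1
      have h1 : ∀ e : {e : D // G.src e = z.label}, W' ⟨(z, e.1), e.2⟩ = π z.label * G.w e.1 :=
        fun e => by simp only [hW', e.2]
      rw [Finset.sum_congr rfl fun e _ => h1 e, ← Finset.mul_sum, sum_fintypeSrc z.label G.w,
        sum_w_src, mul_one]
    rw [← (hasSum_coverEdge sW'S).tsum_eq]
    exact tsum_congr hfun
  -- Reversal exchanges `W` and `W'` but keeps squared gradients, so the energy is half the
  -- symmetrised one.
  have e2 : ∑' d, W d * (g d.1.1 - g d.tip) ^ 2 = ∑' d, W' d * (g d.1.1 - g d.tip) ^ 2 := by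
    rw [← (G.revEquiv v).tsum_eq]
    refine tsum_congr fun d => ?_
    rw [hWrev, revEquiv_tip, revEquiv_src]
    ring
  have e3 : c * ∑' d : G.CoverEdge v, (g d.1.1 - g d.tip) ^ 2
      ≤ 2 * ∑' d, W d * (g d.1.1 - g d.tip) ^ 2 := by
    rw [two_mul]
    nth_rewrite 2 [e2]
    rw [← sWN.tsum_add sW'N, ← tsum_mul_left]
    refine (sN.mul_left c).tsum_le_tsum (fun d => ?_) (sWN.add sW'N)
    rw [← add_mul]
    exact mul_le_mul_of_nonneg_right (hc d.1.2) (sq_nonneg _)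
  have e4 : ∑' x, π x.label * g x ^ 2 ≤ M * ∑' x, g x ^ 2 := by
    rw [← tsum_mul_left]
    exact ha.tsum_le_tsum (fun x => mul_le_mul_of_nonneg_right (hM _) (sq_nonneg _))
      (sg.mul_left M)
  have e5 := hC v g sg
  have hnum : δ * ∑' x, π x.label * g x ^ 2 ≤ 1 / 4 * ∑' d, W d * (g d.1.1 - g d.tip) ^ 2 := by
    have h0 : 0 ≤ ∑' x, π x.label * g x ^ 2 :=
      tsum_nonneg fun x => mul_nonneg (hπ _).le (sq_nonneg _)
    calc δ * ∑' x, π x.label * g x ^ 2 ≤ c / (8 * C * M) * ∑' x, π x.label * g x ^ 2 :=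
          mul_le_mul_of_nonneg_right (min_le_left _ _) h0
      _ ≤ c / (8 * C * M) * (M * (C * ∑' d : G.CoverEdge v, (g d.1.1 - g d.tip) ^ 2)) := by
          gcongr
          exact e4.trans (mul_le_mul_of_nonneg_left e5 hM0.le)
      _ = 1 / 8 * (c * ∑' d : G.CoverEdge v, (g d.1.1 - g d.tip) ^ 2) := by
          field_simp
      _ ≤ 1 / 8 * (2 * ∑' d, W d * (g d.1.1 - g d.tip) ^ 2) := by gcongr
      _ = _ := by ring
  have hpt : ∀ z : G.CoverVertex v, evolve a z ^ 2 / π z.label ≤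
      1 / 2 * (π z.label * g z ^ 2) +
      1 / 2 * (∑ e : {e : D // G.src e = z.label},
        W ⟨(z, e.1), e.2⟩ * g (CoverEdge.tip ⟨(z, e.1), e.2⟩) ^ 2) -
      1 / 4 * (∑ e : {e : D // G.src e = z.label},
        W ⟨(z, e.1), e.2⟩ * (g z - g (CoverEdge.tip ⟨(z, e.1), e.2⟩)) ^ 2) := by
    intro z
    have hz := hπ z.label
    set p : {e : D // G.src e = z.label} → ℝ := fun e => W ⟨(z, e.1), e.2⟩ / π z.label with hp
    set b : {e : D // G.src e = z.label} → ℝ := fun e => g (z.step e.1 e.2) with hb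
    have hWp : ∀ e : {e : D // G.src e = z.label}, W ⟨(z, e.1), e.2⟩ = π z.label * p e :=
      fun e => by rw [hp, mul_div_cancel₀ _ hz.ne']
    -- By stationarity `p` is a probability: the non-lazy step of the time-reversed walk from `z`.
    have hp1 : ∑ e, p e = 1 := by
      rw [hp, ← Finset.sum_div, div_eq_one_iff_eq hz.ne',
        sum_fintypeSrc z.label (fun e => π (G.tgt e) * G.w (G.rev e)), ← hstat z.label]
      have hinv : Function.Involutive G.rev := G.rev_rev
      refine Fintype.sum_equiv hinv.toPerm _ _ fun e => ?_
      simp only [Function.Involutive.coe_toPerm, tgt_rev, src_rev]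
    have key := sq_convex_comb_le p b (g z) (fun e => div_nonneg (hW0 _) hz.le) hp1
    have hev : evolve a z = π z.label * (1 / 2 * g z + 1 / 2 * ∑ e, p e * b e) := by
      have h1 : ∑ e : {e : D // G.src e = z.label}, G.w (G.rev e.1) * a (z.step e.1 e.2)
          = π z.label * ∑ e, p e * b e := by
        rw [Finset.mul_sum]
        refine Finset.sum_congr rfl fun e _ => ?_
        rw [← mul_assoc, ← hWp, hag]
        change _ * (π (G.tgt e.1) * g (z.step e.1 e.2)) =
          π (G.tgt e.1) * G.w (G.rev e.1) * g (z.step e.1 e.2)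
        ring
      rw [evolve, h1, hag z]
      ring
    have h2 : ∑ e : {e : D // G.src e = z.label},
        W ⟨(z, e.1), e.2⟩ * g (CoverEdge.tip ⟨(z, e.1), e.2⟩) ^ 2
          = π z.label * ∑ e, p e * b e ^ 2 := by
      rw [Finset.mul_sum]
      exact Finset.sum_congr rfl fun e _ => by rw [hWp, mul_assoc]; rfl
    have h3 : ∑ e : {e : D // G.src e = z.label},
        W ⟨(z, e.1), e.2⟩ * (g z - g (CoverEdge.tip ⟨(z, e.1), e.2⟩)) ^ 2
          = π z.label * ∑ e, p e * (b e - g z) ^ 2 := by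
      rw [Finset.mul_sum]
      exact Finset.sum_congr rfl fun e _ => by rw [hWp, mul_assoc, ← sub_sq_comm]; rfl
    rw [h2, h3, hev, mul_pow, sq (π z.label), mul_assoc, mul_div_cancel_left₀ _ hz.ne']
    have := mul_le_mul_of_nonneg_left key hz.le
    linarith
  have hR := ((ha.hasSum.mul_left (1 / 2)).add ((hasSum_coverEdge sWT).mul_left (1 / 2))).sub
    ((hasSum_coverEdge sWN).mul_left (1 / 4))
  have hsum : Summable fun x => evolve a x ^ 2 / π x.label :=
    Summable.of_nonneg_of_le (fun x => div_nonneg (sq_nonneg _) (hπ _).le) hpt hR.summable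
  refine ⟨hsum, (hasSum_le hpt hsum.hasSum hR).trans ?_⟩
  rw [e1]
  linarith

/-- The transition probabilities of the walk on the universal cover decay exponentially. -/
theorem exists_decay [Finite V] {π : V → ℝ} (hπ : ∀ v, 0 < π v)
    (hcontr : ∃ ρ, 0 < ρ ∧ ρ < 1 ∧ ∀ (v : V) (a : G.CoverVertex v → ℝ),
      (Summable fun x => a x ^ 2 / π x.label) →
      (Summable fun x => evolve a x ^ 2 / π x.label) ∧
        ∑' x, evolve a x ^ 2 / π x.label ≤ ρ * ∑' x, a x ^ 2 / π x.label) :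
    ∃ K r : ℝ, 0 < K ∧ 0 < r ∧ r < 1 ∧ ∀ (v : V) (a : ℕ → G.CoverVertex v → ℝ)
      (y : G.CoverVertex v), (∀ x ≠ y, a 0 x = 0) → 0 ≤ a 0 y → (∀ n, a (n + 1) = evolve (a n)) →
      ∀ n x, a n x ≤ a 0 y * (K * r ^ n) := by
  obtain ⟨ρ, hρ0, hρ1, hρ⟩ := hcontr
  obtain ⟨M, hM0, hM⟩ := exists_pos_forall_ge π
  obtain ⟨c, hc0, hc⟩ := exists_pos_forall_le hπ
  -- One term of the `L²` sum is at most the whole, which bounds the square of `a n x`; `M / c`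
  -- compares `π` at `x` and `y`.
  refine ⟨√(M / c), √ρ, by positivity, by positivity, by
    rw [Real.sqrt_lt' one_pos]; simpa using hρ1, ?_⟩
  intro v a y h0 hy hstep n x
  have h1 : HasSum (fun x => a 0 x ^ 2 / π x.label) (a 0 y ^ 2 / π y.label) :=
    hasSum_single y fun x hx => by rw [h0 x hx]; simp
  have h2 : ∀ n, (Summable fun x => a n x ^ 2 / π x.label) ∧
      ∑' x, a n x ^ 2 / π x.label ≤ ρ ^ n * (a 0 y ^ 2 / π y.label) := by
    intro n
    induction n with
    | zero => exact ⟨h1.summable, by rw [h1.tsum_eq]; simp⟩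
    | succ n ih =>
      rw [hstep]
      obtain ⟨h3, h4⟩ := hρ v _ ih.1
      refine ⟨h3, h4.trans ?_⟩
      rw [pow_succ', mul_assoc]
      exact mul_le_mul_of_nonneg_left ih.2 hρ0.le
  obtain ⟨h3, h4⟩ := h2 n
  have h5 : a n x ^ 2 / π x.label ≤ ρ ^ n * (a 0 y ^ 2 / π y.label) :=
    (h3.le_tsum x fun z _ => div_nonneg (sq_nonneg _) (hπ _).le).trans h4
  refine abs_le_of_sq_le_sq' ?_ (by positivity) |>.2
  rw [div_le_iff₀ (hπ _)] at h5
  refine h5.trans ?_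
  rw [mul_pow, mul_pow, ← pow_mul, mul_comm n 2, pow_mul, Real.sq_sqrt hρ0.le,
    Real.sq_sqrt (by positivity)]
  have h6 : a 0 y ^ 2 / π y.label * π x.label ≤ a 0 y ^ 2 / c * M := by
    gcongr
    · exact (hπ _).le
    · exact hc _
    · exact hM _
  calc ρ ^ n * (a 0 y ^ 2 / π y.label) * π x.label
      = ρ ^ n * (a 0 y ^ 2 / π y.label * π x.label) := by ring
    _ ≤ ρ ^ n * (a 0 y ^ 2 / c * M) := by gcongr
    _ = _ := by ring

end WeightedMultigraph

/-! ### The Markov property, tail sums and trajectories in the tree. -/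

namespace WeightedMultigraph

open MeasureTheory ProbabilityTheory

section RandomWalk

variable {S E : Type*} {H : WeightedMultigraph S E} {o : S} {Ω : Type*} [MeasurableSpace Ω]
  {μ : Measure Ω} {X : ℕ → Ω → S}

theorem transition_nonneg (x z : S) : 0 ≤ H.transition x z := by
  classical
  refine add_nonneg (mul_nonneg (by norm_num) ?_)
    (mul_nonneg (by norm_num) (tsum_nonneg fun e => H.w_nonneg _))
  split_ifs <;> norm_num

/-- The Markov property. -/
theorem IsRandomWalk.markov [Countable S] [IsFiniteMeasure μ] (h : H.IsRandomWalk o μ X) {s N : ℕ}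
    (hs : s ≤ N) (x y z : S) :
    μ ({ω | X s ω = y} ∩ {ω | X N ω = x} ∩ {ω | X (N + 1) ω = z}) =
      ENNReal.ofReal (H.transition x z) * μ ({ω | X s ω = y} ∩ {ω | X N ω = x}) := by
  classical
  let : MeasurableSpace S := ⊤
  obtain ⟨hm, hlaw⟩ := h
  set C : Set Ω := {ω | X (N + 1) ω = z} with hC
  set Y : Ω → (Fin (N + 1) → S) := fun ω i => X i ω with hY
  have hYm : Measurable Y := measurable_pi_iff.2 fun i => measurable_to_countable' fun x => hm i x
  set L : Set (Fin (N + 1) → S) := {w | w (Fin.last N) = x} with hL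
  have hset : ∀ A : Set (Fin (N + 1) → S), MeasurableSet A := fun A => A.to_countable.measurableSet
  -- There are countably many paths up to time `N`, so it suffices to compare both measures on
  -- single paths, where the laws are given.
  have hν : ((μ.restrict C).map Y).restrict L =
      ENNReal.ofReal (H.transition x z) • (μ.map Y).restrict L := by
    refine Measure.ext_of_singleton fun w => ?_
    rw [Measure.smul_apply, Measure.restrict_apply (hset _), Measure.restrict_apply (hset _),
      smul_eq_mul]
    by_cases hw : w ∈ L
    · rw [Set.inter_eq_left.2 (Set.singleton_subset_iff.2 hw), Measure.map_apply hYm (hset _),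
        Measure.map_apply hYm (hset _), Measure.restrict_apply (hYm (hset _))]
      set x' : ℕ → S := fun i => if hi : i < N + 1 then w ⟨i, hi⟩ else z with hx'
      have h1 : Y ⁻¹' {w} = {ω | ∀ i ≤ N, X i ω = x' i} := by
        ext ω
        simp only [Set.mem_preimage, Set.mem_singleton_iff, Set.mem_ofPred_eq, funext_iff, hY]
        constructor
        · intro h i hi
          rw [hx']
          simp only [dif_pos (Nat.lt_succ_of_le hi)]
          exact h ⟨i, _⟩
        · rintro h ⟨i, hi⟩
          have := h i (Nat.le_of_lt_succ hi)
          simp only [hx', dif_pos hi] at this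
          exact this
      have h2 : Y ⁻¹' {w} ∩ C = {ω | ∀ i ≤ N + 1, X i ω = x' i} := by
        have hz : x' (N + 1) = z := by simp [hx']
        rw [h1, hC]
        ext ω
        simp only [Set.mem_inter_iff, Set.mem_ofPred_eq, Nat.le_succ_iff, Nat.succ_eq_add_one]
        constructor
        · rintro ⟨h3, h4⟩ i (hi | rfl)
          · exact h3 i hi
          · rw [h4, hz]
        · intro h3
          exact ⟨fun i hi => h3 i (Or.inl hi), by rw [h3 _ (Or.inr rfl), hz]⟩
      have hxN : x' N = x := by
        simp only [hx', dif_pos (Nat.lt_succ_self N)]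
        exact hw
      have hz : x' (N + 1) = z := by simp [hx']
      rw [h2, h1, ← ofReal_measureReal, ← ofReal_measureReal, hlaw, hlaw,
        ← ENNReal.ofReal_mul (transition_nonneg x z), Finset.prod_range_succ, hxN, hz]
      congr 1
      ring
    · have : ({w} : Set (Fin (N + 1) → S)) ∩ L = ∅ := by
        rw [Set.singleton_inter_eq_empty]
        exact hw
      rw [this, measure_empty, measure_empty, mul_zero]
  have h3 := congrArg (fun ν => ν {w : Fin (N + 1) → S | w ⟨s, Nat.lt_succ_of_le hs⟩ = y}) hν
  simp only [Measure.smul_apply, Measure.restrict_apply (hset _), smul_eq_mul] at h3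
  rw [Measure.map_apply hYm (hset _), Measure.map_apply hYm (hset _),
    Measure.restrict_apply (hYm (hset _))] at h3
  exact h3

theorem IsRandomWalk.ae_transition_pos [Countable S] [IsFiniteMeasure μ]
    (h : H.IsRandomWalk o μ X) : ∀ᵐ ω ∂μ, ∀ i, 0 < H.transition (X i ω) (X (i + 1) ω) := by
  rw [ae_all_iff]
  intro i
  have h1 : ∀ x z : S, ∀ᵐ ω ∂μ, X i ω = x → X (i + 1) ω = z → 0 < H.transition x z := by
    intro x z
    by_cases hp : 0 < H.transition x z
    · exact Filter.Eventually.of_forall fun _ _ _ => hp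
    · have h2 := h.markov (le_refl i) x x z
      rw [ENNReal.ofReal_of_nonpos (not_lt.1 hp), zero_mul] at h2
      refine measure_mono_null (fun ω hω => ?_) h2
      simp only [Set.mem_compl_iff, Set.mem_ofPred_eq, Classical.not_imp] at hω
      exact ⟨⟨hω.1, hω.1⟩, hω.2.1⟩
  filter_upwards [ae_all_iff.2 fun x => ae_all_iff.2 (h1 x)] with ω hω
  exact hω _ _ rfl rfl

theorem IsRandomWalk.ae_start [IsProbabilityMeasure μ] (h : H.IsRandomWalk o μ X) :
    ∀ᵐ ω ∂μ, X 0 ω = o := by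
  have h1 : μ.real {ω | X 0 ω = o} = 1 := by simpa using h.2 0 fun _ => o
  have h2 : μ {ω | X 0 ω = o} = 1 := by rw [← ofReal_measureReal, h1, ENNReal.ofReal_one]
  exact (prob_compl_eq_zero_iff (h.1 0 o)).2 h2

theorem IsRandomWalk.sum_measure [Countable S] (h : H.IsRandomWalk o μ X) (t : ℕ) {A : Set Ω}
    (hA : MeasurableSet A) : μ A = ∑' x, μ (A ∩ {ω | X t ω = x}) := by
  rw [← measure_iUnion]
  · congr 1
    ext ω
    simp
  · intro x y hxy
    rw [Function.onFun, Set.disjoint_left]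
    rintro ω ⟨-, h1⟩ ⟨-, h2⟩
    exact hxy (h1.symm.trans h2)
  · exact fun x => hA.inter (h.1 t x)

/-- The joint law of two positions, propagated by the transition matrix. -/
theorem IsRandomWalk.measureReal_succ [Countable S] [IsFiniteMeasure μ] (h : H.IsRandomWalk o μ X)
    (s n : ℕ) (y z : S) :
    μ.real ({ω | X s ω = y} ∩ {ω | X (s + (n + 1)) ω = z}) =
      ∑' x, μ.real ({ω | X s ω = y} ∩ {ω | X (s + n) ω = x}) * H.transition x z := by
  rw [measureReal_def, h.sum_measure (s + n) ((h.1 s y).inter (h.1 _ z)),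
    ENNReal.tsum_toReal_eq fun x => measure_ne_top _ _]
  refine tsum_congr fun x => ?_
  rw [Set.inter_right_comm, ← add_assoc, h.markov (Nat.le_add_right s n), ENNReal.toReal_mul,
    ENNReal.toReal_ofReal (transition_nonneg _ _), mul_comm]
  rfl

end RandomWalk

/-- A summable geometric bound for the probability to meet one of `n + 1` vertices at a time
`n > R`. -/
theorem exists_tail_bound {K r : ℝ} (hK : 0 < K) (hr0 : 0 < r) (hr1 : r < 1) :
    ∃ C₁ C₂ : ℝ, 0 < C₁ ∧ 0 < C₂ ∧ ∀ R : ℕ,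
      ∑' m : ℕ, ((R + 1 + m + 1 : ℕ) : ENNReal) * ENNReal.ofReal (K * r ^ (R + 1 + m)) ≤
        ENNReal.ofReal (C₁ * Real.exp (-C₂ * R)) := by
  -- A rate strictly between `r` and `1` absorbs the factor `n + 1`.
  set q : ℝ := (1 + r) / 2 with hq
  have hrq : r < q := by rw [hq]; linarith
  have hq0 : 0 < q := hr0.trans hrq
  have hq1 : q < 1 := by rw [hq]; linarith
  have hrq0 : 0 ≤ r / q := by positivity
  have hrq1 : r / q < 1 := (div_lt_one hq0).2 hrq
  obtain ⟨Q, hQ⟩ := (tendsto_pow_const_mul_const_pow_of_abs_lt_one 1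
    (by rwa [abs_of_nonneg hrq0])).bddAbove_range
  have hQ' : ∀ n : ℕ, (n + 1 : ℝ) * r ^ n ≤ (|Q| + 1) * q ^ n := by
    intro n
    have h1 : (n : ℝ) ^ 1 * (r / q) ^ n ≤ Q := hQ ⟨n, rfl⟩
    have h2 : (r / q) ^ n ≤ 1 := pow_le_one₀ hrq0 hrq1.le
    have h3 : r ^ n = (r / q) ^ n * q ^ n := by rw [div_pow, div_mul_cancel₀ _ (pow_pos hq0 n).ne']
    rw [h3, ← mul_assoc]
    refine mul_le_mul_of_nonneg_right ?_ (by positivity)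
    rw [pow_one] at h1
    linarith [le_abs_self Q]
  have hlog : Real.log q < 0 := Real.log_neg hq0 hq1
  refine ⟨K * (|Q| + 1) * (1 - q)⁻¹, -Real.log q,
    by have : 0 < 1 - q := by linarith
       positivity, by linarith, fun R => ?_⟩
  have hexp : Real.exp (- -Real.log q * R) = q ^ R := by
    rw [neg_neg, mul_comm, Real.exp_nat_mul, Real.exp_log hq0]
  rw [hexp]
  have hg : HasSum (fun m : ℕ => K * (|Q| + 1) * q ^ R * q ^ m) (K * (|Q| + 1) * q ^ R * (1 - q)⁻¹) :=
    (hasSum_geometric_of_lt_one hq0.le hq1).mul_left _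
  calc ∑' m : ℕ, ((R + 1 + m + 1 : ℕ) : ENNReal) * ENNReal.ofReal (K * r ^ (R + 1 + m))
      ≤ ∑' m : ℕ, ENNReal.ofReal (K * (|Q| + 1) * q ^ R * q ^ m) := by
        refine ENNReal.tsum_le_tsum fun m => ?_
        rw [← ENNReal.ofReal_natCast, ← ENNReal.ofReal_mul (by positivity)]
        refine ENNReal.ofReal_le_ofReal ?_
        have h1 := mul_le_mul_of_nonneg_left (hQ' (R + 1 + m)) hK.le
        have h2 : q ^ (R + 1 + m) ≤ q ^ R * q ^ m := by
          rw [← pow_add]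
          exact pow_le_pow_of_le_one hq0.le hq1.le (by lia)
        have h3 : K * (|Q| + 1) * q ^ (R + 1 + m) ≤ K * (|Q| + 1) * (q ^ R * q ^ m) :=
          mul_le_mul_of_nonneg_left h2 (by positivity)
        push_cast at h1 ⊢
        linarith
    _ = ENNReal.ofReal (K * (|Q| + 1) * q ^ R * (1 - q)⁻¹) := by
        rw [← hg.tsum_eq, ENNReal.ofReal_tsum_of_nonneg (fun m => by positivity) hg.summable]
    _ ≤ _ := ENNReal.ofReal_le_ofReal (le_of_eq (by ring))

section Paths

variable {V D : Type*} {G : WeightedMultigraph V D} {v : V}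

instance [Finite D] : Countable (G.CoverVertex v) :=
  Function.Injective.countable (f := fun x : G.CoverVertex v => x.path)
    fun _ _ h => CoverVertex.eq_of_path h

theorem exists_edge_of_transition_pos {S E : Type*} {H : WeightedMultigraph S E} {x z : S}
    (h : 0 < H.transition x z) : x = z ∨ ∃ e, 0 < H.w e ∧ H.src e = x ∧ H.tgt e = z := by
  classical
  by_contra! hne
  have h0 : ∀ e : {e : E // H.src e = x ∧ H.tgt e = z}, H.w e.1 = 0 := by
    rintro ⟨e, he⟩
    by_contra hw
    exact hne.2 e (lt_of_le_of_ne (H.w_nonneg e) (Ne.symm hw)) he.1 he.2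
  simp [transition, hne.1, h0] at h

theorem mem_ball_of_transition_pos {S E : Type*} {H : WeightedMultigraph S E} {X : ℕ → S}
    (h : ∀ i, 0 < H.transition (X i) (X (i + 1))) (t n : ℕ) : X (t + n) ∈ H.ball (X t) n := by
  induction n with
  | zero => exact ⟨[], rfl, by simp, le_rfl⟩
  | succ n ih =>
    obtain ⟨p, hp1, hp2, hp3⟩ := ih
    rcases exists_edge_of_transition_pos (h (t + n)) with h1 | ⟨e, he, h1, h2⟩
    · exact ⟨p, by rw [← add_assoc, ← h1]; exact hp1, hp2, hp3.trans (Nat.le_succ n)⟩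
    · refine ⟨e :: p, ⟨h2, by rw [h1]; exact hp1⟩, ?_, by simpa using hp3⟩
      intro f hf
      rcases List.mem_cons.1 hf with rfl | hf
      · exact he
      · exact hp2 f hf

theorem ball_mono {S E : Type*} {H : WeightedMultigraph S E} (y : S) {m n : ℕ} (h : m ≤ n) :
    H.ball y m ⊆ H.ball y n := fun _ ⟨p, h1, h2, h3⟩ => ⟨p, h1, h2, h3.trans h⟩

/-- Two lists are equal or arise from each other by adding one element in front. -/
def NearList (p q : List D) : Prop := q = p ∨ (∃ e, q = e :: p) ∨ ∃ e, p = e :: q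

theorem NearList.symm {p q : List D} (h : NearList p q) : NearList q p := by
  rcases h with h | h | h
  · exact Or.inl h.symm
  · exact Or.inr (Or.inr h)
  · exact Or.inr (Or.inl h)

theorem NearList.length_le {p q : List D} (h : NearList p q) : p.length ≤ q.length + 1 := by
  rcases h with rfl | ⟨e, rfl⟩ | ⟨e, rfl⟩ <;> simp; lia

/-- The suffix `r` could be lost only by removing the head of `p = r`, and then `q` would be shorter
than `r`. -/
theorem NearList.suffix {r p q : List D} (h : NearList p q) (hr : r <:+ p)
    (hl : r.length ≤ q.length) : r <:+ q := by
  rcases h with rfl | ⟨e, rfl⟩ | ⟨e, rfl⟩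
  · exact hr
  · exact hr.trans (List.suffix_cons e p)
  · rcases List.suffix_cons_iff.1 hr with rfl | h
    · simp at hl
    · exact h

theorem nearList_of_transition_pos {x z : G.CoverVertex v}
    (h : 0 < (G.universalCover v).transition x z) : NearList x.path z.path := by
  rcases exists_edge_of_transition_pos h with rfl | ⟨d, -, rfl, rfl⟩
  · exact Or.inl rfl
  · obtain ⟨⟨x, e⟩, he⟩ := d
    change NearList x.path (G.extendPath e x.path)
    cases x.path with
    | nil => exact Or.inr (Or.inl ⟨e, rfl⟩)
    | cons f p =>
      by_cases hf : f = G.rev e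
      · exact Or.inr (Or.inr ⟨f, congrArg (f :: ·) (if_pos hf).symm⟩)
      · exact Or.inr (Or.inl ⟨e, if_neg hf⟩)

/-- The vertex nearest to the root that is visited after time `t` lies on the ray, and on the path
from the root to the position at time `t`. -/
theorem exists_mem_ray {X : ℕ → G.CoverVertex v}
    (h : ∀ i, 0 < (G.universalCover v).transition (X i) (X (i + 1))) (t : ℕ) :
    ∃ n, X (t + n) ∈ ray X ∧ ∃ k ≤ n, (X (t + n)).path = (X t).path.drop k := by
  have hnear : ∀ i, NearList (X i).path (X (i + 1)).path := fun i =>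
    nearList_of_transition_pos (h i)
  -- By minimality of the depth the walk never leaves the offspring of this vertex from time `t` on:
  -- `hup` goes forward in time from `t + n`, `hdown` back to `t`.
  obtain ⟨n, hn⟩ : ∃ n, ∀ m, (X (t + n)).path.length ≤ (X (t + m)).path.length :=
    ⟨_, fun m => Function.argmin_le (fun n => (X (t + n)).path.length) m⟩
  set p := (X (t + n)).path with hp
  have hup : ∀ m, p <:+ (X (t + n + m)).path := by
    intro m
    induction m with
    | zero => exact List.suffix_refl p
    | succ m ih =>
      refine (hnear (t + n + m)).suffix ih ?_
      have := hn (n + m + 1)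
      rwa [← add_assoc, ← add_assoc] at this
  have hdown : ∀ j m, m + j = n → p <:+ (X (t + m)).path ∧ (X (t + m)).path.length ≤ p.length + j := by
    intro j
    induction j with
    | zero =>
      rintro m rfl
      exact ⟨List.suffix_refl _, le_rfl⟩
    | succ j ih =>
      intro m hm
      obtain ⟨h1, h2⟩ := ih (m + 1) (by lia)
      have h3 := hnear (t + m)
      refine ⟨h3.symm.suffix h1 (hn m), h3.length_le.trans ?_⟩
      have : (X (t + m + 1)).path.length ≤ p.length + j := h2
      lia
  obtain ⟨h1, h2⟩ := hdown n 0 (by simp)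
  simp only [add_zero] at h1 h2
  refine ⟨n, ⟨t + n, rfl, fun u hu => ?_⟩, (X t).path.length - p.length, by lia,
    List.suffix_iff_eq_drop.1 h1⟩
  obtain ⟨m, rfl⟩ := Nat.exists_eq_add_of_le hu
  exact hup m

end Paths

end WeightedMultigraph

/-! ### Exponential hitting bounds. -/

namespace WeightedMultigraph

open MeasureTheory ProbabilityTheory

variable {V D : Type*} {G : WeightedMultigraph V D}

/-- Exponential decay of the probability to be at a given vertex `n` steps after visiting `y`. -/
theorem exists_decay_of_twoCycles [Fintype V] [Fintype D] (hirr : G.transition.IsIrreducible)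
    (htwo : G.TwoCycles) :
    ∃ K r : ℝ, 0 < K ∧ 0 < r ∧ r < 1 ∧ ∀ (v : V) {Ω : Type*} [MeasurableSpace Ω] (μ : Measure Ω)
      [IsProbabilityMeasure μ] (X : ℕ → Ω → G.CoverVertex v),
      (G.universalCover v).IsRandomWalk (G.root v) μ X → ∀ (t n : ℕ) (y x : G.CoverVertex v),
        μ ({ω | X t ω = y} ∩ {ω | X (t + n) ω = x}) ≤
          μ {ω | X t ω = y} * ENNReal.ofReal (K * r ^ n) := by
  have hpos := reflTransGen_of_isIrreducible hirr
  have hconn : ∀ u v, Relation.ReflTransGen (G.Joined Set.univ) u v := fun u v =>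
    (hpos u v).lift id fun _ _ ⟨e, _, h⟩ => ⟨e, Set.mem_univ e, h⟩
  obtain ⟨c₁, -, ⟨hc, -⟩, -⟩ := id htwo
  obtain ⟨e₁, -⟩ := Cycle.ne_nil_iff_exists_mem.1 hc
  have : Nonempty V := ⟨G.src e₁⟩
  obtain ⟨θ, s, hs, hθ, hθ'⟩ := exists_expanding_weights hconn (two_mul_card_lt hconn htwo)
  obtain ⟨π, hπ, hstat⟩ := exists_stationary hpos
  obtain ⟨K, r, hK, hr0, hr1, hdecay⟩ :=
    exists_decay hπ (exists_contraction hπ hstat (exists_poincare hs hθ hθ'))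
  refine ⟨K, r, hK, hr0, hr1, fun v Ω _ μ _ X hX t n y x => ?_⟩
  have h1 := hdecay v (fun n x => μ.real ({ω | X t ω = y} ∩ {ω | X (t + n) ω = x})) y ?_
    measureReal_nonneg ?_ n x
  · simp only [add_zero, Set.inter_self] at h1
    rw [← ofReal_measureReal, ← ofReal_measureReal (s := {ω | X t ω = y}),
      ← ENNReal.ofReal_mul measureReal_nonneg]
    exact ENNReal.ofReal_le_ofReal h1
  · intro z hz
    have : {ω | X t ω = y} ∩ {ω | X (t + 0) ω = z} = ∅ := by
      ext ω
      simp only [add_zero, Set.mem_inter_iff, Set.mem_ofPred_eq, Set.mem_empty_iff_false, iff_false]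
      rintro ⟨h2, h3⟩
      exact hz (h3.symm.trans h2)
    rw [this, measureReal_empty]
  · intro n
    ext z
    rw [hX.measureReal_succ, (hasSum_mul_transition _ z).tsum_eq]

/-- Exponential bound for the probability to meet, at a time `n > R` after visiting `y`, one of
`n + 1` given vertices. -/
theorem exists_hitting_bound [Fintype V] [Fintype D] (hirr : G.transition.IsIrreducible)
    (htwo : G.TwoCycles) :
    ∃ C₁ C₂ : ℝ, 0 < C₁ ∧ 0 < C₂ ∧ ∀ (v : V) {Ω : Type*} [MeasurableSpace Ω] (μ : Measure Ω)
      [IsProbabilityMeasure μ] (X : ℕ → Ω → G.CoverVertex v),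
      (G.universalCover v).IsRandomWalk (G.root v) μ X →
      ∀ (R t : ℕ) (y : G.CoverVertex v) (Z : ℕ → Set (G.CoverVertex v)) (A : Set Ω),
        (∀ k, (Z k).Subsingleton) →
        (∀ᵐ ω ∂μ, ω ∈ A → X t ω = y ∧ ∃ n > R, ∃ k ≤ n, X (t + n) ω ∈ Z k) →
        μ A ≤ μ {ω | X t ω = y} * ENNReal.ofReal (C₁ * Real.exp (-C₂ * R)) := by
  obtain ⟨K, r, hK, hr0, hr1, h⟩ := exists_decay_of_twoCycles hirr htwo
  obtain ⟨C₁, C₂, hC₁, hC₂, hC⟩ := exists_tail_bound hK hr0 hr1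
  refine ⟨C₁, C₂, hC₁, hC₂, fun v Ω _ μ _ X hX R t y Z A hZ hA => ?_⟩
  have h1 : ∀ n k, μ ({ω | X t ω = y} ∩ {ω | X (t + n) ω ∈ Z k}) ≤
      μ {ω | X t ω = y} * ENNReal.ofReal (K * r ^ n) := by
    intro n k
    rcases (hZ k).eq_empty_or_singleton with h2 | ⟨x, h2⟩
    · simp [h2]
    · rw [h2]
      exact h v μ X hX t n y x
  -- Union bound over the times `n = R + 1 + m` and the `n + 1` targets; `A` need not be measurable.
  calc μ A ≤ μ (⋃ m : ℕ, ⋃ k ∈ Finset.range (R + 1 + m + 1),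
        {ω | X t ω = y} ∩ {ω | X (t + (R + 1 + m)) ω ∈ Z k}) := by
        refine measure_mono_ae ?_
        filter_upwards [hA] with ω hω hωA
        obtain ⟨h2, n, hn, k, hk, h3⟩ := hω hωA
        obtain ⟨m, rfl⟩ := Nat.exists_eq_add_of_le (Nat.succ_le_of_lt hn)
        refine Set.mem_iUnion.2 ⟨m, Set.mem_iUnion₂.2 ⟨k, ?_, h2, h3⟩⟩
        exact Finset.mem_range.2 (Nat.lt_succ_of_le hk)
    _ ≤ ∑' m : ℕ, ∑ k ∈ Finset.range (R + 1 + m + 1),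
        μ ({ω | X t ω = y} ∩ {ω | X (t + (R + 1 + m)) ω ∈ Z k}) :=
        (measure_iUnion_le _).trans (ENNReal.tsum_le_tsum fun m => measure_biUnion_finset_le _ _)
    _ ≤ ∑' m : ℕ, μ {ω | X t ω = y} *
        (((R + 1 + m + 1 : ℕ) : ENNReal) * ENNReal.ofReal (K * r ^ (R + 1 + m))) := by
        refine ENNReal.tsum_le_tsum fun m => ?_
        refine (Finset.sum_le_card_nsmul _ _ _ fun k _ => h1 (R + 1 + m) k).trans (le_of_eq ?_)
        rw [Finset.card_range, nsmul_eq_mul, mul_left_comm]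
    _ ≤ _ := by
        rw [ENNReal.tsum_mul_left]
        exact mul_le_mul_right (hC R) _

end WeightedMultigraph

/-! ### The three bounds. -/

open MeasureTheory ProbabilityTheory in
theorem mainTheorem5 {V D : Type*} [Fintype V] [Fintype D] (G : WeightedMultigraph V D)
    (hirr : G.transition.IsIrreducible) (htwo : G.TwoCycles) :
    ∃ C₁ C₂ : ℝ, 0 < C₁ ∧ 0 < C₂ ∧
      ∀ (v : V) {Ω : Type*} [MeasurableSpace Ω] (μ : Measure Ω) [IsProbabilityMeasure μ]
        (X : ℕ → Ω → G.CoverVertex v),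
        (G.universalCover v).IsRandomWalk (G.root v) μ X →
          -- hitting a vertex at distance more than `R` from the root
          (∀ (R : ℕ) (x : G.CoverVertex v), x ∉ (G.universalCover v).ball (G.root v) R →
            μ.real {ω | ∃ t > 0, X t ω = x} ≤ C₁ * Real.exp (-C₂ * R)) ∧
          -- hitting a vertex at distance more than `R` from the present position `y`
          (∀ (R s : ℕ) (x y : G.CoverVertex v), x ∉ (G.universalCover v).ball y R →
            μ {ω | X s ω = y} ≠ 0 →
            (μ[|{ω | X s ω = y}]).real {ω | ∃ t > s, X t ω = x} ≤ C₁ * Real.exp (-C₂ * R)) ∧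
          -- localization of the walk around its ray to infinity
          (∀ R t : ℕ,
            μ.real {ω | WeightedMultigraph.ray (fun n => X n ω) ∩
              (G.universalCover v).ball (X t ω) R = ∅} ≤ C₁ * Real.exp (-C₂ * R))
    := by
  obtain ⟨C₁, C₂, hC₁, hC₂, h⟩ := WeightedMultigraph.exists_hitting_bound hirr htwo
  refine ⟨C₁, C₂, hC₁, hC₂, fun v Ω _ μ _ X hX => ?_⟩
  have hpos := hX.ae_transition_pos
  have hit : ∀ (R s : ℕ) (x y : G.CoverVertex v), x ∉ (G.universalCover v).ball y R →
      μ ({ω | X s ω = y} ∩ {ω | ∃ t > s, X t ω = x}) ≤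
        μ {ω | X s ω = y} * ENNReal.ofReal (C₁ * Real.exp (-C₂ * R)) := by
    intro R s x y hx
    refine h v μ X hX R s y (fun _ => {x}) _ (fun _ => Set.subsingleton_singleton) ?_
    filter_upwards [hpos] with ω hω
    rintro ⟨h1, t, ht, h2⟩
    refine ⟨h1, t - s, ?_, 0, Nat.zero_le _, ?_⟩
    -- A visit within `R` steps would put `x` in the ball.
    · by_contra! hle
      have h3 := WeightedMultigraph.mem_ball_of_transition_pos hω s (t - s)
      rw [Nat.add_sub_cancel' ht.le, h2, h1] at h3
      exact hx (WeightedMultigraph.ball_mono y hle h3)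
    · rw [Nat.add_sub_cancel' ht.le]
      exact h2
  refine ⟨fun R x hx => ?_, fun R s x y hx hy => ?_, fun R t => ?_⟩
  · refine ENNReal.toReal_le_of_le_ofReal (by positivity) ?_
    calc μ {ω | ∃ t > 0, X t ω = x}
        ≤ μ ({ω | X 0 ω = G.root v} ∩ {ω | ∃ t > 0, X t ω = x}) := by
          refine measure_mono_ae ?_
          filter_upwards [hX.ae_start] with ω hω h1
          exact ⟨hω, h1⟩
      _ ≤ μ {ω | X 0 ω = G.root v} * ENNReal.ofReal (C₁ * Real.exp (-C₂ * R)) := hit R 0 x _ hx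
      _ ≤ _ := mul_le_of_le_one_left zero_le prob_le_one
  · refine ENNReal.toReal_le_of_le_ofReal (by positivity) ?_
    rw [cond_apply (hX.1 s y)]
    refine (mul_le_mul_right (hit R s x y hx) _).trans (le_of_eq ?_)
    rw [← mul_assoc, ENNReal.inv_mul_cancel hy (measure_ne_top _ _), one_mul]
  · refine ENNReal.toReal_le_of_le_ofReal (by positivity) ?_
    set B : Set Ω := {ω | WeightedMultigraph.ray (fun n => X n ω) ∩
      (G.universalCover v).ball (X t ω) R = ∅} with hB
    have hBy : ∀ y, μ (B ∩ {ω | X t ω = y}) ≤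
        μ {ω | X t ω = y} * ENNReal.ofReal (C₁ * Real.exp (-C₂ * R)) := by
      intro y
      -- Paths list their last edge first, so `drop k` gives the ancestor of `y` that is `k` levels
      -- up. Fixing the position `y` at time `t` makes these targets deterministic.
      refine h v μ X hX R t y (fun k => {x | x.path = y.path.drop k}) _
        (fun k a ha b hb => WeightedMultigraph.CoverVertex.eq_of_path (ha.trans hb.symm)) ?_
      filter_upwards [hpos] with ω hω
      rintro ⟨h1, h2⟩
      refine ⟨h2, ?_⟩
      obtain ⟨n, h3, k, hk, h4⟩ := WeightedMultigraph.exists_mem_ray hω t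
      refine ⟨n, ?_, k, hk, ?_⟩
      · by_contra! hle
        have h5 := WeightedMultigraph.ball_mono _ hle
          (WeightedMultigraph.mem_ball_of_transition_pos hω t n)
        exact (Set.eq_empty_iff_forall_notMem.1 h1 _) ⟨h3, h5⟩
      · rw [← h2]
        exact h4
    calc μ B = μ (⋃ y, B ∩ {ω | X t ω = y}) := by
          congr 1
          ext ω
          simp
      _ ≤ ∑' y, μ (B ∩ {ω | X t ω = y}) := measure_iUnion_le _
      _ ≤ ∑' y, μ {ω | X t ω = y} * ENNReal.ofReal (C₁ * Real.exp (-C₂ * R)) :=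
          ENNReal.tsum_le_tsum hBy
      _ = _ := by
          have h6 := hX.sum_measure t MeasurableSet.univ
          simp only [Set.univ_inter, measure_univ] at h6
          rw [ENNReal.tsum_mul_right, ← h6, one_mul]
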